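/- **Setting.** For $\gamma\in\mathbb R$ and $K\ge 1$ let $P_K(\gamma)=\exp\!\big(i\gamma\,|1\cdots1\rangle\langle1\cdots1|\big)$ be the $K$-qubit phase gate. A *lattice-surgery circuit* on $K$ data qubits and $A$ ancilla qubits starts with the data qubits in an arbitrary state and the ancillas in a product of $|0\rangle$, $|+\rangle$ and three-qubit CCZ states $|\mathrm{CCZ}\rangle=\mathrm{CCZ}|{+}{+}{+}\rangle$ (the qubits of the CCZ states are counted among the $A$ ancillas). It then performs a sequence of instructions: classically controlled single-qubit Pauli gates; single-qubit Pauli measurements; layers of simultaneous two-qubit Pauli measurements on pairwise disjoint pairs of qubits; two-input Boolean gates on classical bits; and single-qubit phase gates $P_1(\gamma)$. Measurements may be adaptive: whether and in which Pauli basis they are performed may depend on a classical bit that is known when they start. A *logical cycle* is the time of a two-qubit Pauli measurement; a layer of such measurements thus takes one logical cycle, $P_1(\gamma)$ takes $n_P$ logical cycles, and single-qubit Pauli gates, single-qubit Pauli measurements and classical processing take no time; the durations of successive instructions add up. A circuit $V$ is *$Z$-equivalent* to a unitary $U$ on the data qubits if, for all measurement outcomes, the action of $V$ followed by single-qubit Pauli-$Z$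 corrections of the data qubits, which are computed from the measurement outcomes by the classical instructions of $V$, equals the action of $U$ on the data qubits (the ancillas being left in a state that does not depend on the data). **Theorem.** There is a polynomial $p$ such that for every $K\ge2$ there is a lattice-surgery circuit $V$ on $K$ data qubits and $\lfloor\frac{13}{2}K\rfloor$ ancilla qubits, the same for all $\gamma$ and $n_P$, with the following properties. 1. For every $\gamma\in\mathbb R$, $V$ with the phase gate $P_1(\gamma)$ is $Z$-equivalent to $P_K(\gamma)$. 2. $V$ addresses the $K$ data qubits (before the Pauli-$Z$ corrections) during one logical cycle only. 3. $V$ consumes $$\sum_{\ell=1}^{\lceil\log_2K\rceil}\Big\lfloor\tfrac12\big\lceil K/2^{\ell-1}\big\rceil\Big\rfloor=K-1$$ CCZ states; if $K$ is a power of two, this number is $\sum_{\ell=1}^{\lceil\log_2K\rceil}\lfloor K/2^\ell\rfloor$. 4. If $P_1(\gamma)$ takes $n_P$ logical cycles, then $V$ takes $n_P+4\lceil\log_2K\rceil$ logical cycles in total. 5. The measurement bases and the Pauli-$Z$ corrections are efficiently computed from the measurement outcomes: $V$ consists of at most $p(K)$ elementary quantum and classical operations. -/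

import Mathlib

/-! Lattice-surgery circuits: single-qubit Pauli gates, adaptive one- and two-qubit Pauli
measurements, ancillas prepared in `|0⟩`, `|+⟩` and CCZ states, and the single-qubit phase gate. -/

namespace LatticeSurgery

/-- The `K`-qubit phase gate `P_K(γ) = exp(i γ |1…1⟩⟨1…1|)`, in the computational basis. -/
noncomputable def phaseGate (K : ℕ) (γ : ℝ) : Matrix (Fin K → Bool) (Fin K → Bool) ℂ :=
  NormedSpace.exp ((Complex.I * (γ : ℂ)) •
    Matrix.single (fun _ : Fin K => true) (fun _ : Fin K => true) (1 : ℂ))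

/-- `P_K(γ)` is diagonal: it multiplies `|1…1⟩` by `e^{iγ}` and fixes the other basis states. -/
theorem phaseGate_eq_diagonal (K : ℕ) (γ : ℝ) :
    phaseGate K γ = Matrix.diagonal
      (fun x => if x = (fun _ => true) then Complex.exp (Complex.I * γ) else 1) := by
  have h : (Complex.I * (γ : ℂ)) •
      Matrix.single (fun _ : Fin K => true) (fun _ : Fin K => true) (1 : ℂ) =
      Matrix.diagonal (fun x => if x = (fun _ => true) then Complex.I * γ else 0) := by
    ext x y
    by_cases hxy : x = y
    · subst hxy
      by_cases hx : x = fun _ => true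
      · simp [hx]
      · simp [hx, Ne.symm hx]
    · rw [Matrix.diagonal_apply_ne _ hxy, Matrix.smul_apply, Matrix.single_apply, if_neg]
      · simp
      · rintro ⟨rfl, rfl⟩
        exact hxy rfl
  rw [phaseGate, h, Matrix.exp_diagonal]
  congr 1
  funext x
  rw [Pi.coe_exp, ← Complex.exp_eq_exp_ℂ]
  split_ifs <;> simp

/-- A (not necessarily normalized) state vector of qubits labelled by `Q`. -/
abbrev State (Q : Type) := (Q → Bool) → ℂ

/-- The single-qubit Pauli operators. -/
inductive Pauli
  | X
  | Y
  | Z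

section Semantics

variable {Q B : Type} [DecidableEq Q] [DecidableEq B]

/-- The Pauli operator `P` acting on the qubit `q`. -/
noncomputable def Pauli.act (P : Pauli) (q : Q) (ψ : State Q) : State Q := fun x =>
  match P with
  | .X => ψ (Function.update x q (!x q))
  | .Y => (if x q then Complex.I else -Complex.I) * ψ (Function.update x q (!x q))
  | .Z => (if x q then -1 else 1) * ψ x

/-- The orthogonal projection `(1 + (-1)^b T) / 2` onto the `(-1)^b`-eigenspace of an involution
`T`: the effect of measuring `T` with outcome `b`, without renormalization. -/
noncomputable def outcomeProj (T : State Q → State Q) (b : Bool) (ψ : State Q) : State Q :=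
  fun x => (ψ x + (if b then -1 else 1) * T ψ x) / 2

/-- The single-qubit phase gate `P_1(γ)` acting on the qubit `q`. -/
noncomputable def phaseAct (γ : ℝ) (q : Q) (ψ : State Q) : State Q := fun x =>
  (if x q then Complex.exp (Complex.I * γ) else 1) * ψ x

/-- An adaptive two-qubit Pauli measurement. If the classical bit `ctrl` has value `c`, then
`P₁ ⊗ P₂` is measured when `basis c = some (P₁, P₂)`, and nothing is done when `basis c = none`.
The outcome is stored in the classical bit `out`. -/
structure PairMeas (Q B : Type) where
  fst : Q
  snd : Q
  basis : Bool → Option (Pauli × Pauli)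
  ctrl : B
  out : B

/-- The instructions of a lattice-surgery circuit on qubits `Q` with classical bits `B`.
* `gate P q ctrl`: apply the Pauli gate `P` to `q` if the bit `ctrl` is `true`;
* `meas q basis ctrl out`: if `ctrl` has value `c` and `basis c = some P`, then measure `P` on `q`
  and store the outcome in `out`; do nothing if `basis c = none`;
* `logic f a b out`: classical processing, the bit `out` is set to `f a b`;
* `merge ms`: perform the two-qubit measurements `ms` simultaneously;
* `phase q`: apply the single-qubit phase gate `P_1(γ)` to `q`. -/
inductive Op (Q B : Type)
  | gate (P : Pauli) (q : Q) (ctrl : B)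
  | meas (q : Q) (basis : Bool → Option Pauli) (ctrl out : B)
  | logic (f : Bool → Bool → Bool) (a b out : B)
  | merge (ms : List (PairMeas Q B))
  | phase (q : Q)

/-- The qubits that an instruction addresses (with multiplicity). -/
def Op.qubits : Op Q B → List Q
  | .gate _ q _ => [q]
  | .meas q _ _ _ => [q]
  | .logic _ _ _ _ => []
  | .merge ms => ms.flatMap fun p => [p.fst, p.snd]
  | .phase q => [q]

/-- The classical bits that an instruction writes. -/
def Op.writes : Op Q B → List B
  | .gate _ _ _ => []
  | .meas _ _ _ out => [out]
  | .logic _ _ _ out => [out]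
  | .merge ms => ms.map PairMeas.out
  | .phase _ => []

/-- Duration in logical cycles, one cycle being the duration of a two-qubit Pauli measurement;
`nP` is the number of logical cycles taken by `P_1(γ)`. Single-qubit Pauli gates, single-qubit
Pauli measurements and classical processing take no time. -/
def Op.cycles (nP : ℕ) : Op Q B → ℕ
  | .gate _ _ _ => 0
  | .meas _ _ _ _ => 0
  | .logic _ _ _ _ => 0
  | .merge _ => 1
  | .phase _ => nP

/-- Number of elementary (quantum or classical) operations in an instruction. -/
def Op.size : Op Q B → ℕ
  | .merge ms => ms.length
  | _ => 1

/-- Effect of a two-qubit measurement on the state, if the classical bits have the values `m` when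
the measurement starts and its outcome is `ω out`. -/
noncomputable def PairMeas.project (ω m : B → Bool) (p : PairMeas Q B) (ψ : State Q) : State Q :=
  match p.basis (m p.ctrl) with
  | none => ψ
  | some (P₁, P₂) => outcomeProj (fun φ => P₁.act p.fst (P₂.act p.snd φ)) (ω p.out) ψ

/-- Effect of a two-qubit measurement on the current values `m'` of the classical bits, if these
had the values `m` when the measurement started. -/
def PairMeas.record (ω m : B → Bool) (p : PairMeas Q B) (m' : B → Bool) : B → Bool :=
  match p.basis (m p.ctrl) with
  | none => m'
  | some _ => Function.update m' p.out (ω p.out)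

/-- Effect of one instruction on the state and the classical bits, in the branch in which the
measurement that writes to the bit `c` has outcome `ω c`. -/
noncomputable def Op.run (γ : ℝ) (ω : B → Bool) :
    Op Q B → State Q × (B → Bool) → State Q × (B → Bool)
  | .gate P q ctrl, (ψ, m) => (if m ctrl then P.act q ψ else ψ, m)
  | .meas q basis ctrl out, (ψ, m) =>
    match basis (m ctrl) with
    | none => (ψ, m)
    | some P => (outcomeProj (P.act q) (ω out) ψ, Function.update m out (ω out))
  | .logic f a b out, (ψ, m) => (ψ, Function.update m out (f (m a) (m b)))
  | .merge ms, (ψ, m) =>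
    (ms.foldl (fun φ p => p.project ω m φ) ψ, ms.foldl (fun m' p => p.record ω m m') m)
  | .phase q, (ψ, m) => (phaseAct γ q ψ, m)

end Semantics

/-- The product state of data qubits in state `ψ` and ancilla qubits in state `φ`. -/
def tensor {K A : ℕ} (ψ : State (Fin K)) (φ : State (Fin A)) : State (Fin K ⊕ Fin A) :=
  fun x => ψ (fun i => x (.inl i)) * φ (fun a => x (.inr a))

/-- The amplitudes of the state `|CCZ⟩ = CCZ |+++⟩`. -/
noncomputable def cczAmp (a b c : Bool) : ℂ :=
  (if a && b && c then -1 else 1) / (Real.sqrt 8 : ℂ)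

/-- A lattice-surgery circuit on `K` data qubits and `A` ancilla qubits. -/
structure Circuit (K A : ℕ) where
  /-- the number of CCZ states that are consumed -/
  numCCZ : ℕ
  /-- the (pairwise distinct) ancillas that hold the qubits of the CCZ states at the start -/
  ccz : Fin numCCZ × Fin 3 ↪ Fin A
  /-- of the remaining ancillas, those in `plus` start in `|+⟩`, all others in `|0⟩` -/
  plus : Finset (Fin A)
  /-- the instructions, in chronological order -/
  ops : List (Op (Fin K ⊕ Fin A) ℕ)
  /-- the data qubit `i` needs a Pauli-`Z` correction iff the classical bit `corr i` is `true` at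
  the end -/
  corr : Fin K → ℕ
  /-- every classical bit is written at most once (so distinct measurements have distinct outcome
  bits) -/
  writes_nodup : (ops.flatMap Op.writes).Nodup
  /-- simultaneous two-qubit measurements address disjoint pairs of distinct qubits -/
  merge_disjoint : ∀ ms, Op.merge ms ∈ ops → (Op.merge ms).qubits.Nodup

namespace Circuit

variable {K A : ℕ} (V : Circuit K A)

/-- The initial state of the ancilla qubits. -/
noncomputable def ancillaState : State (Fin A) := fun y =>
  (∏ j, cczAmp (y (V.ccz (j, 0))) (y (V.ccz (j, 1))) (y (V.ccz (j, 2)))) *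
    ∏ a ∈ (Finset.univ.map V.ccz)ᶜ,
      if a ∈ V.plus then 1 / (Real.sqrt 2 : ℂ) else if y a then 0 else 1

/-- State and classical bits at the end of the circuit, in the branch with measurement outcomes `ω`,
for the initial data state `ψ`. All classical bits are initially `false`. -/
noncomputable def run (γ : ℝ) (ω : ℕ → Bool) (ψ : State (Fin K)) :
    State (Fin K ⊕ Fin A) × (ℕ → Bool) :=
  V.ops.foldl (fun c o => o.run γ ω c) (tensor ψ V.ancillaState, fun _ => false)

/-- The final state after the Pauli-`Z` corrections of the data qubits. -/
noncomputable def correctedOutput (γ : ℝ) (ω : ℕ → Bool) (ψ : State (Fin K)) :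
    State (Fin K ⊕ Fin A) := fun x =>
  (∏ i, if (V.run γ ω ψ).2 (V.corr i) && x (.inl i) then (-1 : ℂ) else 1) * (V.run γ ω ψ).1 x

/-- `V`, with `P_1(γ)` as its phase gate, is `Z`-equivalent to `U`: for all measurement outcomes,
`V` followed by the Pauli-`Z` corrections maps every data state `ψ` to `U ψ`, leaving the ancillas
in a state `φ` that does not depend on `ψ` (unnormalized; `‖φ‖²` is the probability of the
outcomes). -/
def ZEquivalent (γ : ℝ) (U : Matrix (Fin K → Bool) (Fin K → Bool) ℂ) : Prop :=
  ∀ ω : ℕ → Bool, ∃ φ : State (Fin A), ∀ ψ : State (Fin K),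
    V.correctedOutput γ ω ψ = tensor (U.mulVec ψ) φ

/-- The data qubits are addressed during a single logical cycle (of two-qubit measurements) only. -/
def AddressesDataForOneCycle : Prop :=
  ∃ pre ms post, V.ops = pre ++ Op.merge ms :: post ∧
    ∀ o ∈ pre ++ post, ∀ i : Fin K, Sum.inl i ∉ o.qubits

/-- The total number of logical cycles, if `P_1(γ)` takes `nP` logical cycles. -/
def cycles (nP : ℕ) : ℕ := (V.ops.map (Op.cycles nP)).sum

/-- The total number of elementary quantum and classical operations. The classical ones include
all that is needed to compute the measurement bases and the corrections from the outcomes. -/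
def size : ℕ := (V.ops.map Op.size).sum

end Circuit

end LatticeSurgery

set_option linter.unusedSectionVars false

/-! The phase gate only needs the conjunction of the data bits on one qubit, so it is computed along
a binary tree and uncomputed by measurements. Nodes are numbered as in a heap: the children of j are
2j and 2j+1, the internal nodes are 1, …, K-1, and the leaf K+i belongs to the data qubit i. Each
node j > 1 has an ancilla (its leg) among the first two qubits of the CCZ state of its parent; the
root leg starts in |+⟩.

Ascent. A ZZ measurement with outcome F makes the leg of a leaf equal to the data bit up to the flip
F. At an internal node let a, b be the bits of the children's legs, t that of its own leg and c the
third CCZ qubit, with sign (-1)^(cab). `attach` turns a |0⟩ ancilla e into a copy of c and adds the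
sign (-1)^(ct). The children hold their values only up to flips F₀, F₁, and (a+F₀)(b+F₁) = ab + F₀b
+ F₁a + F₀F₁. The linear terms come from erasing c by X or X⊗Z_b and e by X or X⊗Z_a, according to
F₀ and F₁. The copy e allows both in the same cycle with two-qubit measurements. Summing the sign
over c = e forces t = (a+F₀)(b+F₁)+F, where F consists of F₀F₁ and the two outcomes (`upNode_run`).

Phase and descent. Once the flips are undone, P₁(γ) on the root leg acts as P_K(γ). Measuring X on
that leg leaves a sign (-1)^(ν·value). A sign (-1)^(νab) at a node is removed by erasing b with X or
X⊗Z_a, according to ν, and then a with X; this leaves linear signs at the two children and needs no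
CCZ state (`downNode_run`). At the leaves these signs are Z corrections of the data.

The analysis treats one node at a time, whereas the circuit runs whole levels at once;
`circuitOps_reorders` identifies the two by commuting independent instructions. The invariants
`upState` and `downState` follow the state through the sequential version.

Classical bits by kind: 0 flips of the legs; 1, 2 outcomes in `attach`; 3 to 6 and 10 to 12
auxiliary bits of the erasures; 7, 8 intermediate values for kind 0; 9 signs in the descent; 13
never written. -/

namespace LatticeSurgery

/-! ### Commuting independent instructions, and rescheduling. -/

section Commutation

variable {Q B : Type} [DecidableEq Q] [DecidableEq B]

/-- The classical bits that an instruction reads. -/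
def Op.reads : Op Q B → List B
  | .gate _ _ ctrl => [ctrl]
  | .meas _ _ ctrl _ => [ctrl]
  | .logic _ a b _ => [a, b]
  | .merge ms => ms.map PairMeas.ctrl
  | .phase _ => []

/-- A Pauli operator as a linear map. -/
noncomputable def Pauli.op (P : Pauli) (q : Q) : Module.End ℂ (State Q) where
  toFun := P.act q
  map_add' ψ φ := by cases P <;> ext x <;> simp [Pauli.act, mul_add]
  map_smul' c ψ := by cases P <;> ext x <;> simp [Pauli.act, mul_left_comm]

theorem Pauli.op_apply (P : Pauli) (q : Q) (ψ : State Q) : P.op q ψ = P.act q ψ := rfl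

theorem Pauli.op_commute (P P' : Pauli) {q q' : Q} (h : q ≠ q') :
    Commute (P.op q) (P'.op q') := by
  refine LinearMap.ext fun ψ => ?_
  simp only [Module.End.mul_apply, Pauli.op_apply]
  cases P <;> cases P' <;> ext x <;>
    simp only [Pauli.act, Function.update_of_ne h, Function.update_of_ne h.symm,
      Function.update_comm h] <;> ring

/-- `outcomeProj` as an element of the endomorphism algebra. -/
noncomputable def projOp (T : Module.End ℂ (State Q)) (b : Bool) : Module.End ℂ (State Q) :=
  (1 / 2 : ℂ) • (1 + (if b then -1 else 1 : ℂ) • T)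

theorem projOp_apply (T : Module.End ℂ (State Q)) (b : Bool) (ψ : State Q) :
    projOp T b ψ = outcomeProj T b ψ := by
  ext x
  simp only [projOp, outcomeProj, LinearMap.smul_apply, LinearMap.add_apply, Module.End.one_apply,
    Pi.smul_apply, Pi.add_apply, smul_eq_mul]
  ring

/-- The phase gate as a linear map. -/
noncomputable def phaseOp (γ : ℝ) (q : Q) : Module.End ℂ (State Q) :=
  ((1 + Complex.exp (Complex.I * γ)) / 2) • 1 +
    ((1 - Complex.exp (Complex.I * γ)) / 2) • Pauli.Z.op q

/-- Writing the phase gate as a combination of 1 and Z places it in the algebra generated by the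
Pauli operators of its qubit. -/
theorem phaseOp_apply (γ : ℝ) (q : Q) (ψ : State Q) : phaseOp γ q ψ = phaseAct γ q ψ := by
  ext x
  simp only [phaseOp, phaseAct, LinearMap.smul_apply, LinearMap.add_apply, Module.End.one_apply,
    Pi.smul_apply, Pi.add_apply, smul_eq_mul, Pauli.op_apply, Pauli.act]
  cases x q <;> simp <;> ring

/-- The algebra of operators that act on the qubits in `S` only. -/
noncomputable def localOps (S : Set Q) : Subalgebra ℂ (Module.End ℂ (State Q)) :=
  Algebra.adjoin ℂ {T | ∃ (P : Pauli) (q : Q), q ∈ S ∧ T = P.op q}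

theorem Pauli.op_mem_localOps (P : Pauli) {q : Q} {S : Set Q} (h : q ∈ S) :
    P.op q ∈ localOps S :=
  Algebra.subset_adjoin ⟨P, q, h, rfl⟩

theorem projOp_mem_localOps {S : Set Q} {T : Module.End ℂ (State Q)} (h : T ∈ localOps S)
    (b : Bool) : projOp T b ∈ localOps S :=
  Subalgebra.smul_mem _ (Subalgebra.add_mem _ (Subalgebra.one_mem _)
    (Subalgebra.smul_mem _ h _)) _

theorem phaseOp_mem_localOps (γ : ℝ) {q : Q} {S : Set Q} (h : q ∈ S) :
    phaseOp γ q ∈ localOps S :=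
  Subalgebra.add_mem _ (Subalgebra.smul_mem _ (Subalgebra.one_mem _) _)
    (Subalgebra.smul_mem _ (Pauli.op_mem_localOps _ h) _)

/-- It suffices to check generators, first on one side and then on the other. -/
theorem localOps_commute {S S' : Set Q} (h : Disjoint S S') {T T' : Module.End ℂ (State Q)}
    (hT : T ∈ localOps S) (hT' : T' ∈ localOps S') : Commute T T' := by
  refine Algebra.commute_of_mem_adjoin_of_forall_mem_commute hT' ?_
  rintro _ ⟨P', q', hq', rfl⟩
  refine (Algebra.commute_of_mem_adjoin_of_forall_mem_commute hT ?_).symm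
  rintro _ ⟨P, q, hq, rfl⟩
  exact Pauli.op_commute _ _ fun e => Set.disjoint_left.1 h hq (e ▸ hq')

/-- The operator that a two-qubit measurement applies. -/
noncomputable def PairMeas.effect (ω m : B → Bool) (p : PairMeas Q B) : Module.End ℂ (State Q) :=
  match p.basis (m p.ctrl) with
  | none => 1
  | some (P₁, P₂) => projOp (P₁.op p.fst * P₂.op p.snd) (ω p.out)

theorem PairMeas.effect_apply (ω m : B → Bool) (p : PairMeas Q B) (ψ : State Q) :
    p.effect ω m ψ = p.project ω m ψ := by
  unfold PairMeas.effect PairMeas.project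
  cases p.basis (m p.ctrl) with
  | none => rfl
  | some P => simp only [projOp_apply]; rfl

theorem PairMeas.effect_mem (ω m : B → Bool) (p : PairMeas Q B) {S : Set Q}
    (h₁ : p.fst ∈ S) (h₂ : p.snd ∈ S) : p.effect ω m ∈ localOps S := by
  unfold PairMeas.effect
  split
  · exact Subalgebra.one_mem _
  · exact projOp_mem_localOps (Subalgebra.mul_mem _ (Pauli.op_mem_localOps _ h₁)
      (Pauli.op_mem_localOps _ h₂)) _

/-- The operator that an instruction applies, if the classical bits have the values `m`. -/
noncomputable def Op.effect (γ : ℝ) (ω m : B → Bool) : Op Q B → Module.End ℂ (State Q)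
  | .gate P q ctrl => if m ctrl then P.op q else 1
  | .meas q basis ctrl out =>
    match basis (m ctrl) with
    | none => 1
    | some P => projOp (P.op q) (ω out)
  | .logic _ _ _ _ => 1
  | .merge ms => ms.foldl (fun T p => p.effect ω m * T) 1
  | .phase q => phaseOp γ q

/-- The values of the classical bits after an instruction. -/
def Op.memory (ω : B → Bool) (m : B → Bool) : Op Q B → B → Bool
  | .gate _ _ _ => m
  | .meas _ basis ctrl out =>
    match basis (m ctrl) with
    | none => m
    | some _ => Function.update m out (ω out)
  | .logic f a b out => Function.update m out (f (m a) (m b))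
  | .merge ms => ms.foldl (fun m' p => p.record ω m m') m
  | .phase _ => m

theorem Op.run_eq (γ : ℝ) (ω : B → Bool) (o : Op Q B) (ψ : State Q) (m : B → Bool) :
    o.run γ ω (ψ, m) = (o.effect γ ω m ψ, o.memory ω m) := by
  cases o with
  | gate P q ctrl =>
    simp only [Op.run, Op.effect, Op.memory]
    split <;> rfl
  | meas q basis ctrl out =>
    simp only [Op.run, Op.effect, Op.memory]
    cases basis (m ctrl) with
    | none => rfl
    | some P => simp only [projOp_apply]; rfl
  | logic f a b out => rfl
  | merge ms =>
    have h : ∀ (ms : List (PairMeas Q B)) (T : Module.End ℂ (State Q)) (ψ : State Q),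
        (ms.foldl (fun T p => p.effect ω m * T) T) ψ =
          ms.foldl (fun φ p => p.project ω m φ) (T ψ) := by
      intro ms
      induction ms with
      | nil => intro T ψ; rfl
      | cons p ms ih =>
        intro T ψ
        simp only [List.foldl_cons]
        rw [ih, Module.End.mul_apply, PairMeas.effect_apply]
    simp only [Op.run, Op.effect, Op.memory, h, Module.End.one_apply]
  | phase q => simp only [Op.run, Op.effect, Op.memory, phaseOp_apply]

theorem Op.effect_mem (γ : ℝ) (ω m : B → Bool) (o : Op Q B) :
    o.effect γ ω m ∈ localOps {q | q ∈ o.qubits} := by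
  cases o with
  | gate P q ctrl =>
    simp only [Op.effect]
    split
    · exact Pauli.op_mem_localOps _ (by simp [Op.qubits])
    · exact Subalgebra.one_mem _
  | meas q basis ctrl out =>
    simp only [Op.effect]
    split
    · exact Subalgebra.one_mem _
    · exact projOp_mem_localOps (Pauli.op_mem_localOps _ (by simp [Op.qubits])) _
  | logic f a b out => exact Subalgebra.one_mem _
  | merge ms =>
    have h : ∀ (S : Set Q) (ms : List (PairMeas Q B)) (T : Module.End ℂ (State Q)),
        T ∈ localOps S → (∀ p ∈ ms, p.fst ∈ S ∧ p.snd ∈ S) →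
        ms.foldl (fun T p => p.effect ω m * T) T ∈ localOps S := by
      intro S ms
      induction ms with
      | nil => intro T hT _; exact hT
      | cons p ms ih =>
        intro T hT hS
        have hp := hS p (by simp)
        exact ih _ (Subalgebra.mul_mem _ (p.effect_mem ω m hp.1 hp.2) hT)
          fun p' hp' => hS p' (by simp [hp'])
    refine h _ ms 1 (Subalgebra.one_mem _) fun p hp => ?_
    simp only [Op.qubits, Set.mem_ofPred_eq, List.mem_flatMap]
    exact ⟨⟨p, hp, by simp⟩, ⟨p, hp, by simp⟩⟩
  | phase q => exact phaseOp_mem_localOps _ (by simp [Op.qubits])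

theorem Op.effect_congr (γ : ℝ) (ω : B → Bool) {m m' : B → Bool} (o : Op Q B)
    (h : ∀ b ∈ o.reads, m b = m' b) : o.effect γ ω m = o.effect γ ω m' := by
  cases o with
  | gate P q ctrl => simp only [Op.effect, h ctrl (by simp [Op.reads])]
  | meas q basis ctrl out => simp only [Op.effect, h ctrl (by simp [Op.reads])]
  | logic f a b out => rfl
  | merge ms =>
    simp only [Op.effect]
    refine List.foldl_ext _ _ _ fun T p hp => ?_
    have : m p.ctrl = m' p.ctrl := h _ (by simpa [Op.reads] using ⟨p, hp, rfl⟩)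
    simp only [PairMeas.effect, this]
  | phase q => rfl

theorem PairMeas.record_of_ne (ω m m' : B → Bool) (p : PairMeas Q B) {b : B} (h : b ≠ p.out) :
    p.record ω m m' b = m' b := by
  unfold PairMeas.record
  cases p.basis (m p.ctrl) with
  | none => rfl
  | some P => exact Function.update_of_ne h _ _

theorem Op.memory_of_notMem (ω m : B → Bool) (o : Op Q B) {b : B} (h : b ∉ o.writes) :
    o.memory ω m b = m b := by
  cases o with
  | gate P q ctrl => rfl
  | meas q basis ctrl out =>
    simp only [Op.memory]
    cases basis (m ctrl) with
    | none => rfl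
    | some P => exact Function.update_of_ne (by simpa [Op.writes] using h) _ _
  | logic f a c out => exact Function.update_of_ne (by simpa [Op.writes] using h) _ _
  | merge ms =>
    have key : ∀ (ms : List (PairMeas Q B)) (m' : B → Bool), (∀ p ∈ ms, b ≠ p.out) →
        ms.foldl (fun m' p => p.record ω m m') m' b = m' b := by
      intro ms
      induction ms with
      | nil => intro m' _; rfl
      | cons p ms ih =>
        intro m' hp
        rw [List.foldl_cons, ih _ fun p' hp' => hp p' (by simp [hp']),
          p.record_of_ne _ _ _ (hp p (by simp))]
    refine key ms m fun p hp e => h ?_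
    simpa [Op.writes] using ⟨p, hp, e.symm⟩
  | phase q => rfl

theorem Op.memory_congr (ω : B → Bool) {m m' : B → Bool} (o : Op Q B)
    (h : ∀ b ∈ o.reads, m b = m' b) {b : B} (hb : m b = m' b) :
    o.memory ω m b = o.memory ω m' b := by
  cases o with
  | gate P q ctrl => exact hb
  | meas q basis ctrl out =>
    simp only [Op.memory, ← h ctrl (by simp [Op.reads])]
    cases basis (m ctrl) with
    | none => exact hb
    | some P => simp only [Function.update_apply, hb]
  | logic f a c out =>
    simp only [Op.memory, ← h a (by simp [Op.reads]), ← h c (by simp [Op.reads]),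
      Function.update_apply, hb]
  | merge ms =>
    have key : ∀ (ms : List (PairMeas Q B)) (n n' : B → Bool),
        (∀ p ∈ ms, m p.ctrl = m' p.ctrl) → n b = n' b →
        ms.foldl (fun n p => p.record ω m n) n b = ms.foldl (fun n p => p.record ω m' n) n' b := by
      intro ms
      induction ms with
      | nil => intro n n' _ hn; exact hn
      | cons p ms ih =>
        intro n n' hp hn
        rw [List.foldl_cons, List.foldl_cons]
        refine ih _ _ (fun p' hp' => hp p' (by simp [hp'])) ?_
        simp only [PairMeas.record, ← hp p (by simp)]
        cases p.basis (m p.ctrl) with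
        | none => exact hn
        | some P => simp only [Function.update_apply, hn]
    exact key ms m m' (fun p hp => h _ (by simpa [Op.reads] using ⟨p, hp, rfl⟩)) hb
  | phase q => exact hb

/-- Two instructions are independent if they act on different qubits and neither writes a classical
bit that the other one reads or writes. -/
structure Op.Indep (o o' : Op Q B) : Prop where
  qubits : ∀ q ∈ o.qubits, q ∉ o'.qubits
  reads : ∀ b ∈ o.reads, b ∉ o'.writes
  writes : ∀ b ∈ o.writes, b ∉ o'.reads
  writes' : ∀ b ∈ o.writes, b ∉ o'.writes

/-- Neither instruction changes the bits that select the other's effect, so both orders apply the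
same two operators, which commute because they are local to disjoint sets of qubits. Each bit is
changed by at most one of the two. -/
theorem Op.Indep.run_comm {o o' : Op Q B} (h : o.Indep o') (γ : ℝ) (ω : B → Bool)
    (s : State Q × (B → Bool)) : o'.run γ ω (o.run γ ω s) = o.run γ ω (o'.run γ ω s) := by
  obtain ⟨ψ, m⟩ := s
  simp only [Op.run_eq]
  have h₁ : ∀ b ∈ o'.reads, o.memory ω m b = m b := fun b hb =>
    o.memory_of_notMem ω m fun hw => h.writes b hw hb
  have h₂ : ∀ b ∈ o.reads, o'.memory ω m b = m b := fun b hb =>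
    o'.memory_of_notMem ω m (h.reads b hb)
  refine Prod.ext ?_ (funext fun b => ?_)
  · rw [o'.effect_congr γ ω h₁, o.effect_congr γ ω h₂]
    have hd : Disjoint {q | q ∈ o.qubits} {q | q ∈ o'.qubits} :=
      Set.disjoint_left.2 fun q hq => h.qubits q hq
    exact (LinearMap.congr_fun
      (localOps_commute hd (o.effect_mem γ ω m) (o'.effect_mem γ ω m)).eq ψ).symm
  · change o'.memory ω (o.memory ω m) b = o.memory ω (o'.memory ω m) b
    by_cases hb : b ∈ o.writes
    · have hb' := h.writes' b hb
      rw [o'.memory_of_notMem ω _ hb']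
      exact (o.memory_congr ω h₂ (o'.memory_of_notMem ω m hb')).symm
    · rw [o.memory_of_notMem ω _ hb]
      exact o'.memory_congr ω h₁ (o.memory_of_notMem ω m hb)

/-- Execution of a list of instructions. -/
noncomputable def runAll (γ : ℝ) (ω : B → Bool) (l : List (Op Q B)) (s : State Q × (B → Bool)) :
    State Q × (B → Bool) :=
  l.foldl (fun c o => o.run γ ω c) s

@[simp] theorem runAll_nil (γ : ℝ) (ω : B → Bool) (s : State Q × (B → Bool)) :
    runAll γ ω ([] : List (Op Q B)) s = s := rfl

@[simp] theorem runAll_cons (γ : ℝ) (ω : B → Bool) (o : Op Q B) (l : List (Op Q B))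
    (s : State Q × (B → Bool)) : runAll γ ω (o :: l) s = runAll γ ω l (o.run γ ω s) := rfl

theorem runAll_append (γ : ℝ) (ω : B → Bool) (l l' : List (Op Q B)) (s : State Q × (B → Bool)) :
    runAll γ ω (l ++ l') s = runAll γ ω l' (runAll γ ω l s) :=
  List.foldl_append ..

/-- `l'` is another schedule of the instructions `l`: it has the same effect, writes the same bits
and consists of the same number of elementary operations. -/
structure Reorders (l l' : List (Op Q B)) : Prop where
  run : ∀ γ ω s, runAll γ ω l s = runAll γ ω l' s
  writes : (l.flatMap Op.writes).Perm (l'.flatMap Op.writes)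
  size : (l.map Op.size).sum = (l'.map Op.size).sum

namespace Reorders

theorem refl (l : List (Op Q B)) : Reorders l l := ⟨fun _ _ _ => rfl, .refl _, rfl⟩

theorem trans {l l' l'' : List (Op Q B)} (h : Reorders l l') (h' : Reorders l' l'') :
    Reorders l l'' :=
  ⟨fun γ ω s => (h.run γ ω s).trans (h'.run γ ω s), h.writes.trans h'.writes,
    h.size.trans h'.size⟩

theorem append {l₁ l₁' l₂ l₂' : List (Op Q B)} (h₁ : Reorders l₁ l₁') (h₂ : Reorders l₂ l₂') :
    Reorders (l₁ ++ l₂) (l₁' ++ l₂') :=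
  ⟨fun γ ω s => by rw [runAll_append, runAll_append, h₁.run, h₂.run],
    by simpa only [List.flatMap_append] using h₁.writes.append h₂.writes,
    by simp only [List.map_append, List.sum_append, h₁.size, h₂.size]⟩

theorem flatMap {f g : ℕ → List (Op Q B)} (N : List ℕ) (h : ∀ j ∈ N, Reorders (f j) (g j)) :
    Reorders (N.flatMap f) (N.flatMap g) := by
  induction N with
  | nil => exact refl _
  | cons j N ih =>
    simp only [List.flatMap_cons]
    exact (h j (by simp)).append (ih fun i hi => h i (by simp [hi]))

theorem cons_comm {o : Op Q B} {l : List (Op Q B)} (h : ∀ o' ∈ l, o.Indep o') :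
    Reorders (o :: l) (l ++ [o]) := by
  induction l with
  | nil => exact refl _
  | cons o' l ih =>
    have h₁ : Reorders (o :: o' :: l) (o' :: o :: l) :=
      ⟨fun γ ω s => by simp only [runAll_cons, (h o' (by simp)).run_comm],
        by simpa only [List.flatMap_cons, List.append_assoc] using
          (List.perm_append_comm.append_right _ :
            ((o.writes ++ o'.writes) ++ l.flatMap Op.writes).Perm _),
        by simp only [List.map_cons, List.sum_cons]; omega⟩
    exact h₁.trans ((refl [o']).append (ih fun o'' ho => h o'' (by simp [ho])))

theorem append_comm {l l' : List (Op Q B)} (h : ∀ o ∈ l, ∀ o' ∈ l', o.Indep o') :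
    Reorders (l ++ l') (l' ++ l) := by
  induction l with
  | nil => simpa using refl l'
  | cons o l ih =>
    have h₁ := (refl [o]).append (ih fun o' ho => h o' (by simp [ho]))
    have h₂ := (cons_comm (h o (by simp))).append (refl l)
    simp only [List.append_assoc, List.cons_append] at h₁ h₂ ⊢
    exact h₁.trans h₂

/-- Two consecutive layers can be executed node by node. -/
theorem flatMap_append {f g : ℕ → List (Op Q B)} {N : List ℕ} (hN : N.Nodup)
    (h : ∀ i ∈ N, ∀ j ∈ N, i ≠ j → ∀ o ∈ f i, ∀ o' ∈ g j, o.Indep o') :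
    Reorders (N.flatMap f ++ N.flatMap g) (N.flatMap fun j => f j ++ g j) := by
  induction N with
  | nil => exact refl _
  | cons j N ih =>
    obtain ⟨hj, hN⟩ := List.nodup_cons.1 hN
    simp only [List.flatMap_cons]
    have h₁ : Reorders (N.flatMap f ++ g j) (g j ++ N.flatMap f) := by
      refine append_comm fun o ho o' ho' => ?_
      obtain ⟨i, hi, ho⟩ := List.mem_flatMap.1 ho
      exact h i (by simp [hi]) j (by simp) (fun e => hj (e ▸ hi)) o ho o' ho'
    have h₂ := ih hN fun i hi k hk => h i (by simp [hi]) k (by simp [hk])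
    have h₃ := ((refl (f j)).append (h₁.append (refl (N.flatMap g)))).trans
      ((refl (f j)).append (by
        rw [List.append_assoc]; exact (refl (g j)).append h₂))
    simpa only [List.append_assoc] using h₃

/-- A layer reads all its controls before it starts. Splitting it is harmless as soon as no outcome
of the first part controls the second; the projections keep their order, so disjointness of qubits
plays no role here. -/
theorem merge_append {ms ms' : List (PairMeas Q B)} (h : ∀ p ∈ ms, ∀ p' ∈ ms', p.out ≠ p'.ctrl) :
    Reorders [Op.merge (ms ++ ms')] [Op.merge ms, Op.merge ms'] := by
  refine ⟨fun γ ω s => ?_, ?_, ?_⟩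
  · obtain ⟨ψ, m⟩ := s
    have hm : ∀ p' ∈ ms', m p'.ctrl = (ms.foldl (fun m' p => p.record ω m m') m) p'.ctrl := by
      intro p' hp'
      refine ((Op.merge ms).memory_of_notMem ω m ?_).symm
      simp only [Op.writes, List.mem_map, not_exists, not_and]
      exact fun p hp => h p hp p' hp'
    simp only [runAll_cons, runAll_nil, Op.run, List.foldl_append]
    refine Prod.ext (List.foldl_ext _ _ _ fun φ p hp => ?_)
      (List.foldl_ext _ _ _ fun n p hp => ?_)
    · simp only [PairMeas.project, hm p hp]
    · simp only [PairMeas.record, hm p hp]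
  · simp [Op.writes]
  · simp [Op.size]

theorem merge_nil : Reorders [Op.merge ([] : List (PairMeas Q B))] [] :=
  ⟨fun _ _ _ => rfl, .refl _, rfl⟩

theorem merge_flatMap {N : List ℕ} {g : ℕ → List (PairMeas Q B)}
    (h : ∀ i ∈ N, ∀ j ∈ N, ∀ p ∈ g i, ∀ p' ∈ g j, p.out ≠ p'.ctrl) :
    Reorders [Op.merge (N.flatMap g)] (N.flatMap fun j => [Op.merge (g j)]) := by
  induction N with
  | nil => exact merge_nil
  | cons j N ih =>
    simp only [List.flatMap_cons]
    refine (merge_append fun p hp p' hp' => ?_).trans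
      ((refl [Op.merge (g j)]).append (ih fun i hi k hk => h i (by simp [hi]) k (by simp [hk])))
    obtain ⟨i, hi, hp'⟩ := List.mem_flatMap.1 hp'
    exact h j (by simp) i (by simp [hi]) p hp p' hp'

end Reorders

end Commutation

/-! ### Erasing a qubit, and copying one with an attached controlled Z. -/

section Gadgets

variable {Q B : Type} [DecidableEq Q] [DecidableEq B]

/-- The sign `(-1)^b`. -/
def sgn (b : Bool) : ℂ := if b then -1 else 1

@[simp] theorem sgn_false : sgn false = 1 := rfl

@[simp] theorem sgn_true : sgn true = -1 := rfl

theorem sgn_mul_self (a : Bool) : sgn a * sgn a = 1 := by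
  cases a <;> simp

/-- The two-qubit measurement in `erase`. -/
def erasePair (q o : Q) (ctrl n : B) : PairMeas Q B :=
  ⟨q, o, fun c => if c then some (.X, .Z) else none, ctrl, n⟩

/-- The instructions of `erase` that take no time. -/
def eraseRest (q o : Q) (ctrl n x k w : B) : List (Op Q B) :=
  [.meas q (fun c => if c then none else some .X) ctrl x,
    .meas q (fun c => if c then some .Z else none) ctrl k,
    .gate .Z o k,
    .logic xor n x w]

/-- Measure `X` on `q` if `ctrl` is `false`, and `X` on `q` times `Z` on `o` if `ctrl` is `true`, and
disentangle `q`. The outcome is stored in `w`. -/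
def erase (q o : Q) (ctrl n x k w : B) : List (Op Q B) :=
  .merge [erasePair q o ctrl n] :: eraseRest q o ctrl n x k w

theorem erase_run (γ : ℝ) (ω m : B → Bool) {q o : Q} {ctrl n x k w : B} (hqo : o ≠ q)
    (hn : ctrl ≠ n) (hx : ctrl ≠ x) (hnx : n ≠ x) (hnk : n ≠ k) (hxk : x ≠ k)
    (mn : m n = false) (mx : m x = false) (mk : m k = false) :
    ∃ (χ : Bool → ℂ) (m' : B → Bool),
      (∀ b, b ≠ n → b ≠ x → b ≠ k → b ≠ w → m' b = m b) ∧
      ∀ Φ : State Q, runAll γ ω (erase q o ctrl n x k w) (Φ, m) =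
        (fun z => χ (z q) * ∑ v : Bool, sgn (v && xor (m' w) (m ctrl && z o)) *
          Φ (Function.update z q v), m') := by
  cases hc : m ctrl with
  | false =>
    refine ⟨fun v => sgn (v && ω x) / 2, Function.update (Function.update m x (ω x)) w (ω x),
      fun b _ h₂ _ h₄ => by rw [Function.update_of_ne h₄, Function.update_of_ne h₂],
      fun Φ => ?_⟩
    simp only [erase, eraseRest, erasePair, runAll_cons, runAll_nil, Op.run, List.foldl_cons,
      List.foldl_nil, PairMeas.project, PairMeas.record, hc, Function.update_of_ne hx,
      Function.update_of_ne hnx, Function.update_of_ne hxk.symm, mn, mk, if_false,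
      Function.update_self, Bool.false_xor, Bool.false_eq_true]
    refine Prod.ext (funext fun z => ?_) rfl
    cases hz : z q <;> cases ω x <;>
      simp [outcomeProj, Pauli.act, hz] <;>
      simp [← hz, Function.update_eq_self] <;> ring
  | true =>
    refine ⟨fun v => if v = ω k then sgn (v && ω n) / 2 else 0,
      Function.update (Function.update (Function.update m n (ω n)) k (ω k)) w (ω n),
      fun b h₁ _ h₃ h₄ => by
        rw [Function.update_of_ne h₄, Function.update_of_ne h₃, Function.update_of_ne h₁],
      fun Φ => ?_⟩
    simp only [erase, eraseRest, erasePair, runAll_cons, runAll_nil, Op.run, List.foldl_cons,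
      List.foldl_nil, PairMeas.project, PairMeas.record, hc, Function.update_of_ne hn,
      Function.update_of_ne hnx.symm, Function.update_of_ne hxk, Function.update_of_ne hnk, mx,
      if_true, Function.update_self, Bool.xor_false]
    refine Prod.ext (funext fun z => ?_) rfl
    cases hz : z q <;> cases ho : z o <;> cases ω k <;> cases ω n <;>
      simp [outcomeProj, Pauli.act, hz, ho, Function.update_of_ne hqo] <;>
      simp [← hz, Function.update_eq_self] <;> ring

theorem meas_X_run (γ : ℝ) (ω m : B → Bool) (q : Q) (ctrl out : B) :
    ∃ χ : Bool → ℂ, ∀ Φ : State Q, (Op.meas q (fun _ => some .X) ctrl out).run γ ω (Φ, m) =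
      (fun z => χ (z q) * ∑ v : Bool, sgn (v && ω out) * Φ (Function.update z q v),
        Function.update m out (ω out)) := by
  refine ⟨fun v => sgn (v && ω out) / 2, fun Φ => ?_⟩
  simp only [Op.run]
  refine Prod.ext (funext fun z => ?_) rfl
  cases hz : z q <;> cases ω out <;>
    simp [outcomeProj, Pauli.act, hz] <;>
    simp [← hz, Function.update_eq_self] <;> ring

/-- Entangle `e`, which is in the state `|0⟩`, such that it becomes a copy of `c`, while a
controlled `Z` gate acts between `e` and `t`. -/
def attach (c e t : Q) (i α β : B) : List (Op Q B) :=
  [.merge [⟨e, t, fun _ => some (.X, .Z), i, α⟩], .gate .Z e α,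
    .merge [⟨c, e, fun _ => some (.Z, .Z), i, β⟩], .gate .X e β, .gate .Z t β]

/-- On |0⟩ the X_e Z_t measurement with its Z_e correction produces ∑ₑ (-1)^(et)|e⟩. The Z_c Z_e
measurement and X_e^β then force e = c; the flip of e leaves (-1)^(βt), cancelled by Z_t^β. -/
theorem attach_run (γ : ℝ) (ω m : B → Bool) {c e t : Q} {i α β : B} (hce : c ≠ e) (hte : t ≠ e)
    {E : State Q} {W : (Q → Bool) → Bool}
    (hE : ∀ z v, E (Function.update z e v) = E z) (hW : ∀ z v, W (Function.update z e v) = W z) :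
    runAll γ ω (attach c e t i α β)
      (fun z => E z * (if z e then 0 else 1) * sgn (z c && W z), m) =
      (fun z => E z * (1 / 2) * (if z c = z e then 1 else 0) * sgn (z c && xor (W z) (z t)),
        Function.update (Function.update m α (ω α)) β (ω β)) := by
  simp only [attach, runAll_cons, runAll_nil, Op.run, List.foldl_cons, List.foldl_nil,
    PairMeas.project, PairMeas.record, Function.update_self]
  refine Prod.ext (funext fun z => ?_) rfl
  cases hc : z c <;> cases he : z e <;> cases ht : z t <;> cases hw : W z <;>
    cases ω α <;> cases ω β <;>
    simp [outcomeProj, Pauli.act, hc, he, ht, hw, Function.update_of_ne hce,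
      Function.update_of_ne hte, hE, hW] <;> ring

end Gadgets

/-- The classical bit of kind `s` that belongs to the node `j` of the tree. -/
def bit (s j : ℕ) : ℕ := Nat.pair s j

@[simp] theorem bit_inj {s s' j j' : ℕ} : bit s j = bit s' j' ↔ s = s' ∧ j = j' :=
  Nat.pair_eq_pair

/-! ### Computation and uncomputation at a single node. -/

section Nodes

variable {K A : ℕ} (anc : ℕ → Fin A)

/-- The ancilla that carries, in the `Z` basis, the value of the node `j` of the tree. -/
def leg (K : ℕ) (anc : ℕ → Fin A) (j : ℕ) : Fin K ⊕ Fin A := Sum.inr (anc j)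

/-- For a node `j`, `car (2 * j + 1)` is the third qubit of its CCZ state, and `car (2 * j)` is an
ancilla to which this qubit is copied. -/
def car (K : ℕ) (anc : ℕ → Fin A) (u : ℕ) : Fin K ⊕ Fin A := Sum.inr (anc (2 * K + u))

/-- First two-qubit measurement at a node. -/
def upPair₁ (K : ℕ) (anc : ℕ → Fin A) (j : ℕ) : PairMeas (Fin K ⊕ Fin A) ℕ :=
  -- The basis is constant; `bit 13 0` is a dummy control that no instruction writes.
  ⟨car K anc (2 * j), leg K anc j, fun _ => some (.X, .Z), bit 13 0, bit 1 j⟩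

/-- Pauli correction after `upPair₁`. -/
def upRest₁ (K : ℕ) (anc : ℕ → Fin A) (j : ℕ) : List (Op (Fin K ⊕ Fin A) ℕ) :=
  [.gate .Z (car K anc (2 * j)) (bit 1 j)]

/-- Second two-qubit measurement at a node. -/
def upPair₂ (K : ℕ) (anc : ℕ → Fin A) (j : ℕ) : PairMeas (Fin K ⊕ Fin A) ℕ :=
  ⟨car K anc (2 * j + 1), car K anc (2 * j), fun _ => some (.Z, .Z), bit 13 0, bit 2 j⟩

/-- Pauli corrections after `upPair₂`. -/
def upRest₂ (K : ℕ) (anc : ℕ → Fin A) (j : ℕ) : List (Op (Fin K ⊕ Fin A) ℕ) :=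
  [.gate .X (car K anc (2 * j)) (bit 2 j), .gate .Z (leg K anc j) (bit 2 j)]

/-- The third layer of two-qubit measurements at a node: the two halves of the output of the CCZ
state are measured, corrected by the frame of the respective other input. -/
def upPairs₃ (K : ℕ) (anc : ℕ → Fin A) (j : ℕ) : List (PairMeas (Fin K ⊕ Fin A) ℕ) :=
  [erasePair (car K anc (2 * j + 1)) (leg K anc (2 * j + 1)) (bit 0 (2 * j)) (bit 3 (2 * j + 1)),
    erasePair (car K anc (2 * j)) (leg K anc (2 * j)) (bit 0 (2 * j + 1)) (bit 3 (2 * j))]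

/-- Single-qubit instructions after `upPairs₃`, for the first pair. -/
def upEraseC (K : ℕ) (anc : ℕ → Fin A) (j : ℕ) : List (Op (Fin K ⊕ Fin A) ℕ) :=
  eraseRest (car K anc (2 * j + 1)) (leg K anc (2 * j + 1)) (bit 0 (2 * j)) (bit 3 (2 * j + 1))
    (bit 4 (2 * j + 1)) (bit 5 (2 * j + 1)) (bit 6 (2 * j + 1))

/-- Single-qubit instructions after `upPairs₃`, for the second pair. -/
def upEraseE (K : ℕ) (anc : ℕ → Fin A) (j : ℕ) : List (Op (Fin K ⊕ Fin A) ℕ) :=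
  eraseRest (car K anc (2 * j)) (leg K anc (2 * j)) (bit 0 (2 * j + 1)) (bit 3 (2 * j))
    (bit 4 (2 * j)) (bit 5 (2 * j)) (bit 6 (2 * j))

/-- Computation of the frame `bit 0 j` of the node `j`. -/
def upLogic (K A : ℕ) (j : ℕ) : List (Op (Fin K ⊕ Fin A) ℕ) :=
  [.logic and (bit 0 (2 * j)) (bit 0 (2 * j + 1)) (bit 7 j),
    .logic xor (bit 6 (2 * j)) (bit 6 (2 * j + 1)) (bit 8 j),
    .logic xor (bit 7 j) (bit 8 j) (bit 0 j)]

/-- Single-qubit and classical instructions after `upPairs₃`. -/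
def upRest₃ (K : ℕ) (anc : ℕ → Fin A) (j : ℕ) : List (Op (Fin K ⊕ Fin A) ℕ) :=
  upEraseC K anc j ++ upEraseE K anc j ++ upLogic K A j

/-- The computation of the value of the node `j` from those of its children. -/
def upNode (K : ℕ) (anc : ℕ → Fin A) (j : ℕ) : List (Op (Fin K ⊕ Fin A) ℕ) :=
  [.merge [upPair₁ K anc j]] ++ upRest₁ K anc j ++ [.merge [upPair₂ K anc j]] ++ upRest₂ K anc j ++
    [.merge (upPairs₃ K anc j)] ++ upRest₃ K anc j

/-- The two-qubit measurement in the uncomputation of a node. -/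
def downPair (K : ℕ) (anc : ℕ → Fin A) (j : ℕ) : PairMeas (Fin K ⊕ Fin A) ℕ :=
  erasePair (leg K anc (2 * j + 1)) (leg K anc (2 * j)) (bit 9 j) (bit 10 j)

/-- The other instructions of the uncomputation of a node. -/
def downRest (K : ℕ) (anc : ℕ → Fin A) (j : ℕ) : List (Op (Fin K ⊕ Fin A) ℕ) :=
  eraseRest (leg K anc (2 * j + 1)) (leg K anc (2 * j)) (bit 9 j) (bit 10 j) (bit 11 j) (bit 12 j)
    (bit 9 (2 * j + 1)) ++
  [.meas (leg K anc (2 * j)) (fun _ => some .X) (bit 9 j) (bit 9 (2 * j))]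

/-- The removal of the sign `(-1)^(value of j)`, by measuring the carriers of the two children,
which leaves such signs for the children. -/
def downNode (K : ℕ) (anc : ℕ → Fin A) (j : ℕ) : List (Op (Fin K ⊕ Fin A) ℕ) :=
  .merge [downPair K anc j] :: downRest K anc j

/-- The two erasures of a node can be executed one after the other. -/
def upNodeSeq (K : ℕ) (anc : ℕ → Fin A) (j : ℕ) : List (Op (Fin K ⊕ Fin A) ℕ) :=
  attach (car K anc (2 * j + 1)) (car K anc (2 * j)) (leg K anc j) (bit 13 0) (bit 1 j) (bit 2 j) ++
  (erase (car K anc (2 * j + 1)) (leg K anc (2 * j + 1)) (bit 0 (2 * j)) (bit 3 (2 * j + 1))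
    (bit 4 (2 * j + 1)) (bit 5 (2 * j + 1)) (bit 6 (2 * j + 1)) ++
  (erase (car K anc (2 * j)) (leg K anc (2 * j)) (bit 0 (2 * j + 1)) (bit 3 (2 * j))
    (bit 4 (2 * j)) (bit 5 (2 * j)) (bit 6 (2 * j)) ++ upLogic K A j))

variable {anc}

theorem inr_anc_ne (hanc : Set.InjOn anc (Set.Iio (4 * K))) {i j : ℕ} (hi : i < 4 * K)
    (hj : j < 4 * K) (h : i ≠ j) : (Sum.inr (anc i) : Fin K ⊕ Fin A) ≠ Sum.inr (anc j) :=
  fun e => h (hanc hi hj (Sum.inr_injective e))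

/-- The second pair measurement shares no qubit with the single-qubit instructions that finish the
first erasure, so it may be postponed past them. -/
theorem upNode_reorders (hanc : Set.InjOn anc (Set.Iio (4 * K))) {j : ℕ}
    (hjK : j < K) : Reorders (upNode K anc j) (upNodeSeq K anc j) := by
  have h₁ : Reorders [Op.merge (upPairs₃ K anc j)]
      [.merge [erasePair (car K anc (2 * j + 1)) (leg K anc (2 * j + 1)) (bit 0 (2 * j))
        (bit 3 (2 * j + 1))],
      .merge [erasePair (car K anc (2 * j)) (leg K anc (2 * j)) (bit 0 (2 * j + 1))
        (bit 3 (2 * j))]] :=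
    Reorders.merge_append (ms := [_]) (by simp [erasePair])
  have h₂ := Reorders.cons_comm (l := upEraseC K anc j)
    (o := .merge [erasePair (car K anc (2 * j)) (leg K anc (2 * j)) (bit 0 (2 * j + 1))
        (bit 3 (2 * j))]) (by
      intro o ho
      have e : ∀ i i', i < 4 * K → i' < 4 * K → i ≠ i' →
        (Sum.inr (anc i) : Fin K ⊕ Fin A) ≠ Sum.inr (anc i') := fun i i' => inr_anc_ne hanc
      simp only [upEraseC, eraseRest, List.mem_cons, List.not_mem_nil, or_false] at ho
      rcases ho with rfl | rfl | rfl | rfl <;> constructor <;>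
        simp [Op.qubits, Op.reads, Op.writes, erasePair, -Sum.inr.injEq, car, leg] <;>
        first
          | omega
          | (constructor <;> (apply e <;> omega)))
  have h₃ := (h₁.append (.refl (upRest₃ K anc j))).trans
    ((Reorders.refl [_]).append (h₂.append (.refl (upEraseE K anc j ++ upLogic K A j))))
  have h₄ := (Reorders.refl ([.merge [upPair₁ K anc j]] ++ upRest₁ K anc j ++
    [.merge [upPair₂ K anc j]] ++ upRest₂ K anc j)).append h₃
  simpa [upNode, upNodeSeq, upRest₃, attach, erase, upRest₁, upRest₂, upPair₁, upPair₂, upEraseC,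
    upEraseE] using h₄

/-- The initial amplitude of the CCZ state and the additional ancilla at the node `j`. -/
noncomputable def nodeAmp (K : ℕ) (anc : ℕ → Fin A) (j : ℕ) (z : Fin K ⊕ Fin A → Bool) : ℂ :=
  (if z (car K anc (2 * j)) then 0 else 1) *
    sgn (z (car K anc (2 * j + 1)) && (z (leg K anc (2 * j)) && z (leg K anc (2 * j + 1))))

/-- `E` stands for the rest of the state. It may depend on all three legs, in particular on that of
`j` through the CCZ state of the parent, but not on the two qubits that are erased. -/
theorem upNode_run (γ : ℝ) (ω m : ℕ → Bool) (hanc : Set.InjOn anc (Set.Iio (4 * K))) {j : ℕ}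
    (hj : 1 ≤ j) (hjK : j < K) (mu : ∀ s u, 3 ≤ s → s ≤ 5 → u < 2 * j + 2 → m (bit s u) = false) :
    ∃ (χ : Bool → Bool → ℂ) (m' : ℕ → Bool),
      (∀ s i, (s = 0 ∧ i ≠ j) ∨ (3 ≤ s ∧ s ≤ 5 ∧ i < 2 * j) ∨ 9 ≤ s →
        m' (bit s i) = m (bit s i)) ∧
      ∀ E : State (Fin K ⊕ Fin A),
      (∀ z v, E (Function.update z (car K anc (2 * j)) v) = E z) →
      (∀ z v, E (Function.update z (car K anc (2 * j + 1)) v) = E z) →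
      runAll γ ω (upNode K anc j) (fun z => E z * nodeAmp K anc j z, m) =
      (fun z => E z * χ (z (car K anc (2 * j))) (z (car K anc (2 * j + 1))) *
        (if z (leg K anc j) = xor (xor (z (leg K anc (2 * j))) (m (bit 0 (2 * j))) &&
          xor (z (leg K anc (2 * j + 1))) (m (bit 0 (2 * j + 1)))) (m' (bit 0 j)) then 1 else 0),
        m') := by
  have e : ∀ i i', i < 4 * K → i' < 4 * K → i ≠ i' →
    (Sum.inr (anc i) : Fin K ⊕ Fin A) ≠ Sum.inr (anc i') := fun i i' => inr_anc_ne hanc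
  have hce : car K anc (2 * j + 1) ≠ car K anc (2 * j) := by apply e <;> omega
  have hle : ∀ i, i < 2 * K → leg K anc i ≠ car K anc (2 * j) := fun i hi => by
    apply e <;> omega
  have hlc : ∀ i, i < 2 * K → leg K anc i ≠ car K anc (2 * j + 1) := fun i hi => by
    apply e <;> omega
  have hE₁ := fun E hE => attach_run γ ω m (i := bit 13 0) (α := bit 1 j) (β := bit 2 j) hce
    (hle j (by omega)) (E := E)
    (W := fun z => z (leg K anc (2 * j)) && z (leg K anc (2 * j + 1))) hE (fun z v => by
      rw [Function.update_of_ne (hle _ (by omega)), Function.update_of_ne (hle _ (by omega))])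
  set m₁ := Function.update (Function.update m (bit 1 j) (ω (bit 1 j))) (bit 2 j) (ω (bit 2 j))
    with hm₁
  have hm₁' : ∀ s i, s ≠ 1 → s ≠ 2 → m₁ (bit s i) = m (bit s i) := fun s i h₁ h₂ => by
    rw [hm₁, Function.update_of_ne (by simp [h₂]), Function.update_of_ne (by simp [h₁])]
  obtain ⟨χ₂, m₂, hm₂, run₂⟩ := erase_run γ ω m₁ (q := car K anc (2 * j + 1))
    (o := leg K anc (2 * j + 1)) (ctrl := bit 0 (2 * j)) (n := bit 3 (2 * j + 1))
    (x := bit 4 (2 * j + 1)) (k := bit 5 (2 * j + 1)) (w := bit 6 (2 * j + 1))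
    (hlc _ (by omega)) (by simp) (by simp) (by simp) (by simp) (by simp)
    (by rw [hm₁' _ _ (by simp) (by simp), mu] <;> omega)
    (by rw [hm₁' _ _ (by simp) (by simp), mu] <;> omega)
    (by rw [hm₁' _ _ (by simp) (by simp), mu] <;> omega)
  have hm₂' : ∀ s i, s ≠ 1 → s ≠ 2 → (3 ≤ s → s ≤ 6 → i ≠ 2 * j + 1) →
      m₂ (bit s i) = m (bit s i) := fun s i h₁ h₂ h₃ => by
    rw [hm₂, hm₁' s i h₁ h₂] <;> simp only [ne_eq, bit_inj] <;> omega
  obtain ⟨χ₃, m₃, hm₃, run₃⟩ := erase_run γ ω m₂ (q := car K anc (2 * j))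
    (o := leg K anc (2 * j)) (ctrl := bit 0 (2 * j + 1)) (n := bit 3 (2 * j))
    (x := bit 4 (2 * j)) (k := bit 5 (2 * j)) (w := bit 6 (2 * j))
    (hle _ (by omega)) (by simp) (by simp) (by simp) (by simp) (by simp)
    (by rw [hm₂' _ _ (by simp) (by simp), mu] <;> omega)
    (by rw [hm₂' _ _ (by simp) (by simp), mu] <;> omega)
    (by rw [hm₂' _ _ (by simp) (by simp), mu] <;> omega)
  have hm₃' : ∀ s i, s ≠ 1 → s ≠ 2 → (3 ≤ s → s ≤ 6 → i ≠ 2 * j ∧ i ≠ 2 * j + 1) →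
      m₃ (bit s i) = m (bit s i) := fun s i h₁ h₂ h₃ => by
    rw [hm₃, hm₂' s i h₁ h₂] <;> simp only [ne_eq, bit_inj] <;> omega
  have hF₀ : m₃ (bit 0 (2 * j)) = m (bit 0 (2 * j)) := hm₃' _ _ (by simp) (by simp) (by simp)
  have hF₁ : m₃ (bit 0 (2 * j + 1)) = m (bit 0 (2 * j + 1)) :=
    hm₃' _ _ (by simp) (by simp) (by simp)
  have hG₀ : m₁ (bit 0 (2 * j)) = m (bit 0 (2 * j)) := hm₁' _ _ (by simp) (by simp)
  have hG₁ : m₂ (bit 0 (2 * j + 1)) = m (bit 0 (2 * j + 1)) :=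
    hm₂' _ _ (by simp) (by simp) (by simp)
  have hw : m₃ (bit 6 (2 * j + 1)) = m₂ (bit 6 (2 * j + 1)) := by apply hm₃ <;> simp
  set w₀ := m₃ (bit 6 (2 * j)) with hw₀
  set w₁ := m₂ (bit 6 (2 * j + 1)) with hw₁
  set F₀ := m (bit 0 (2 * j)) with hF₀'
  set F₁ := m (bit 0 (2 * j + 1)) with hF₁'
  refine ⟨fun ve vc => χ₃ ve * χ₂ vc,
    Function.update (Function.update (Function.update m₃ (bit 7 j) (F₀ && F₁)) (bit 8 j)
      (xor w₀ w₁)) (bit 0 j) (xor (F₀ && F₁) (xor w₀ w₁)), ?_, ?_⟩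
  · intro s i h
    rw [Function.update_of_ne, Function.update_of_ne, Function.update_of_ne, hm₃'] <;>
      simp only [ne_eq, bit_inj] <;> omega
  intro E hEe hEc
  rw [(upNode_reorders hanc hjK).run, upNodeSeq, runAll_append, runAll_append, runAll_append]
  have h₁ : (fun z => E z * nodeAmp K anc j z) = fun z => E z *
      (if z (car K anc (2 * j)) then 0 else 1) * sgn (z (car K anc (2 * j + 1)) &&
        (z (leg K anc (2 * j)) && z (leg K anc (2 * j + 1)))) :=
    funext fun z => by rw [nodeAmp, mul_assoc]
  rw [h₁, hE₁ E hEe, run₂, run₃]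
  simp only [upLogic, runAll_cons, runAll_nil, Op.run, hF₀, hF₁, hG₀, hG₁]
  refine Prod.ext (funext fun z => ?_) ?_
  · simp only [Fintype.sum_bool, Function.update_self, hEe, hEc, Function.update_of_ne hce,
      Function.update_of_ne hce.symm, Function.update_of_ne (hle j (by omega)),
      Function.update_of_ne (hle (2 * j) (by omega)), Function.update_of_ne (hlc j (by omega)),
      Function.update_of_ne (hle (2 * j + 1) (by omega)),
      Function.update_of_ne (hlc (2 * j) (by omega)),
      Function.update_of_ne (hlc (2 * j + 1) (by omega))]
    -- The double sum reduces to c = e = v. The sum over v of (-1)^(v(ab+t+F₀b+F₁a+w₀+w₁)) is 2 or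
    -- 0, and the 2 cancels the 1/2 from `attach`. What remains is a finite check on seven bits.
    generalize χ₃ (z (car K anc (2 * j))) = y₃
    generalize χ₂ (z (car K anc (2 * j + 1))) = y₂
    generalize z (leg K anc (2 * j)) = a
    generalize z (leg K anc (2 * j + 1)) = b
    generalize z (leg K anc j) = t
    clear_value w₀ w₁ F₀ F₁
    have hw' : ∀ x : ℂ, x + x = 2 * x := fun x => (two_mul x).symm
    rcases Bool.eq_false_or_eq_true t with rfl | rfl <;> cases F₀ <;> cases F₁ <;>
      cases a <;> cases b <;> cases w₀ <;> cases w₁ <;> simp <;> ring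
  · have h67 : ∀ (f : ℕ → Bool) (v : Bool) (i : ℕ),
        Function.update f (bit 7 j) v (bit 6 i) = f (bit 6 i) := fun f v i =>
      Function.update_of_ne (by simp) _ _
    have h87 : ∀ (f : ℕ → Bool) (v : Bool) (i : ℕ),
        Function.update f (bit 8 j) v (bit 7 i) = f (bit 7 i) := fun f v i =>
      Function.update_of_ne (by simp) _ _
    simp only [h67, h87, Function.update_self, ← hw₀, hw]

/-- With ν = `m (bit 9 j)`, erasing the second leg multiplies by (-1)^(b(w+νa)), whose quadratic
part cancels the given sign; erasing the first leg adds a sign linear in a. -/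
theorem downNode_run (γ : ℝ) (ω m : ℕ → Bool) (hanc : Set.InjOn anc (Set.Iio (4 * K))) {j : ℕ}
    (hjK : j < K) (mu : ∀ s, 10 ≤ s → s ≤ 12 → m (bit s j) = false) :
    ∃ (χ : Bool → Bool → ℂ) (m' : ℕ → Bool),
      (∀ s i, (s = 9 ∧ i ≠ 2 * j ∧ i ≠ 2 * j + 1) ∨ (10 ≤ s ∧ i ≠ j) →
        m' (bit s i) = m (bit s i)) ∧
      ∀ (E : State (Fin K ⊕ Fin A)) (a b : (Fin K ⊕ Fin A → Bool) → Bool),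
      (∀ z v, E (Function.update z (leg K anc (2 * j)) v) = E z) →
      (∀ z v, E (Function.update z (leg K anc (2 * j + 1)) v) = E z) →
      (∀ z i v, a (Function.update z (leg K anc i) v) = a z) →
      (∀ z i v, b (Function.update z (leg K anc i) v) = b z) →
      runAll γ ω (downNode K anc j) (fun z => E z *
        (if z (leg K anc (2 * j)) = a z then 1 else 0) *
        (if z (leg K anc (2 * j + 1)) = b z then 1 else 0) *
        sgn (m (bit 9 j) && (a z && b z)), m) =
      (fun z => E z * χ (z (leg K anc (2 * j))) (z (leg K anc (2 * j + 1))) *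
        (sgn (m' (bit 9 (2 * j)) && a z) * sgn (m' (bit 9 (2 * j + 1)) && b z)), m') := by
  have hab : leg K anc (2 * j) ≠ leg K anc (2 * j + 1) := by
    apply inr_anc_ne hanc <;> omega
  obtain ⟨χ₁, m₁, hm₁, run₁⟩ := erase_run γ ω m (q := leg K anc (2 * j + 1))
    (o := leg K anc (2 * j)) (ctrl := bit 9 j) (n := bit 10 j)
    (x := bit 11 j) (k := bit 12 j) (w := bit 9 (2 * j + 1))
    hab (by simp) (by simp) (by simp) (by simp) (by simp)
    (mu _ (by omega) (by omega)) (mu _ (by omega) (by omega)) (mu _ (by omega) (by omega))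
  obtain ⟨χ₂, run₂⟩ := meas_X_run γ ω m₁ (leg K anc (2 * j)) (bit 9 j) (bit 9 (2 * j))
  refine ⟨fun va vb => χ₂ va * χ₁ vb, Function.update m₁ (bit 9 (2 * j)) (ω (bit 9 (2 * j))),
    ?_, ?_⟩
  · intro s i h
    rw [Function.update_of_ne, hm₁] <;> simp only [ne_eq, bit_inj] <;> omega
  intro E a b hEa hEb ha hb
  have hl : downNode K anc j = erase (leg K anc (2 * j + 1)) (leg K anc (2 * j)) (bit 9 j)
      (bit 10 j) (bit 11 j) (bit 12 j) (bit 9 (2 * j + 1)) ++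
      [.meas (leg K anc (2 * j)) (fun _ => some .X) (bit 9 j) (bit 9 (2 * j))] := rfl
  rw [hl, runAll_append, run₁, runAll_cons, runAll_nil, run₂]
  refine Prod.ext (funext fun z => ?_) rfl
  simp only [Fintype.sum_bool, Function.update_self, hEa, hEb, ha, hb, Function.update_of_ne hab,
    Function.update_of_ne hab.symm, Function.update_of_ne (show bit 9 (2 * j + 1) ≠ bit 9 (2 * j)
    by simp)]
  generalize m₁ (bit 9 (2 * j + 1)) = w
  generalize m (bit 9 j) = ν
  generalize ω (bit 9 (2 * j)) = l
  generalize a z = x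
  generalize b z = y
  cases ν <;> cases x <;> cases y <;> cases w <;> cases l <;> simp <;> ring

end Nodes

/-! ### The layered circuit and its equivalence with a node-by-node order. -/

section Schedule

variable {Q B : Type} [DecidableEq Q] [DecidableEq B]

/-- Consecutive layers can be executed node by node. -/
theorem Reorders.layers {N : List ℕ} (hN : N.Nodup) (fs : List (ℕ → List (Op Q B)))
    (h : ∀ i ∈ N, ∀ j ∈ N, i ≠ j → ∀ f ∈ fs, ∀ g ∈ fs, ∀ o ∈ f i, ∀ o' ∈ g j, o.Indep o') :
    Reorders (fs.flatMap fun f => N.flatMap f) (N.flatMap fun j => fs.flatMap fun f => f j) := by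
  induction fs with
  | nil =>
    have : N.flatMap (fun _ => ([] : List (Op Q B))) = [] := by simp
    simpa [this] using Reorders.refl _
  | cons f fs ih =>
    simp only [List.flatMap_cons]
    refine ((Reorders.refl (N.flatMap f)).append (ih fun i hi j hj hij f hf g hg =>
      h i hi j hj hij f (by simp [hf]) g (by simp [hg]))).trans
      (Reorders.flatMap_append hN fun i hi j hj hij o ho o' ho' => ?_)
    obtain ⟨g, hg, ho'⟩ := List.mem_flatMap.1 ho'
    exact h i hi j hj hij f (by simp) g (by simp [hg]) o ho o' ho'

variable {K A : ℕ}

/-- The internal nodes of depth `d` of the tree with `K` leaves. -/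
def nodes (K d : ℕ) : List ℕ :=
  List.range' (min (2 ^ d) K) (min (2 ^ (d + 1)) K - min (2 ^ d) K)

theorem mem_nodes {K d j : ℕ} : j ∈ nodes K d ↔ 2 ^ d ≤ j ∧ j < 2 ^ (d + 1) ∧ j < K := by
  rw [nodes, List.mem_range'_1]
  have : 2 ^ d ≤ 2 ^ (d + 1) := Nat.pow_le_pow_right (by norm_num) (by omega)
  omega

theorem nodup_nodes (K d : ℕ) : (nodes K d).Nodup := List.nodup_range'

theorem flatMap_nodes (hK : 1 ≤ K) (L : ℕ) :
    (List.range L).flatMap (nodes K) = List.range' 1 (min (2 ^ L) K - 1) := by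
  induction L with
  | zero => simp [hK]
  | succ L ih =>
    rw [List.range_succ, List.flatMap_append, ih, List.flatMap_singleton, nodes]
    have h₁ : 1 ≤ 2 ^ L := Nat.one_le_two_pow
    have h₂ : 2 ^ L ≤ 2 ^ (L + 1) := Nat.pow_le_pow_right (by norm_num) (by omega)
    have h₃ := List.range'_append_1 (s := 1) (m := min (2 ^ L) K - 1)
      (n := min (2 ^ (L + 1)) K - min (2 ^ L) K)
    rw [show 1 + (min (2 ^ L) K - 1) = min (2 ^ L) K by omega] at h₃
    rw [h₃]
    congr 1
    omega

/-- The measurements that copy the data qubits to the leaves of the tree. -/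
def leafPair (anc : ℕ → Fin A) (i : Fin K) : PairMeas (Fin K ⊕ Fin A) ℕ :=
  ⟨.inl i, leg K anc (K + i), fun _ => some (.Z, .Z), bit 13 0, bit 0 (K + i)⟩

/-- The measurements that copy the data qubits to the leaves of the tree. -/
def leafPairs (K : ℕ) (anc : ℕ → Fin A) : List (PairMeas (Fin K ⊕ Fin A) ℕ) :=
  (List.finRange K).map (leafPair anc)

/-- The computation of the values of the nodes `N`, after the first layer of measurements. -/
def upLevelRest (K : ℕ) (anc : ℕ → Fin A) (N : List ℕ) : List (Op (Fin K ⊕ Fin A) ℕ) :=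
  N.flatMap (upRest₁ K anc) ++ (.merge (N.map (upPair₂ K anc)) :: (N.flatMap (upRest₂ K anc) ++
    (.merge (N.flatMap (upPairs₃ K anc)) :: N.flatMap (upRest₃ K anc))))

/-- The computation of the values of the nodes `N`. -/
def upLevel (K : ℕ) (anc : ℕ → Fin A) (N : List ℕ) : List (Op (Fin K ⊕ Fin A) ℕ) :=
  .merge (N.map (upPair₁ K anc)) :: upLevelRest K anc N

/-- The uncomputation of the values of the nodes `N`. -/
def downLevel (K : ℕ) (anc : ℕ → Fin A) (N : List ℕ) : List (Op (Fin K ⊕ Fin A) ℕ) :=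
  .merge (N.map (downPair K anc)) :: N.flatMap (downRest K anc)

/-- Pauli corrections after which the carriers of all nodes have the values of the nodes. -/
def frameGates (K : ℕ) (anc : ℕ → Fin A) : List (Op (Fin K ⊕ Fin A) ℕ) :=
  (List.range' 1 (2 * K - 1)).map fun j => .gate .X (leg K anc j) (bit 0 j)

/-- The phase gate at the root of the tree, and the removal of the root. -/
def rootOps (K : ℕ) (anc : ℕ → Fin A) : List (Op (Fin K ⊕ Fin A) ℕ) :=
  [.phase (leg K anc 1), .meas (leg K anc 1) (fun _ => some .X) (bit 0 1) (bit 9 1)]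

/-- The instructions after the layer of measurements that addresses the data qubits, for a tree of
depth `L + 1`. -/
def laterOps (K : ℕ) (anc : ℕ → Fin A) (L : ℕ) : List (Op (Fin K ⊕ Fin A) ℕ) :=
  upLevelRest K anc (nodes K L).reverse ++
    ((List.range L).reverse.flatMap (fun d => upLevel K anc (nodes K d).reverse) ++
    (frameGates K anc ++ (rootOps K anc ++
    (List.range (L + 1)).flatMap fun d => downLevel K anc (nodes K d))))

/-- The layer of measurements that addresses the data qubits. -/
def firstLayer (K : ℕ) (anc : ℕ → Fin A) (L : ℕ) : List (PairMeas (Fin K ⊕ Fin A) ℕ) :=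
  leafPairs K anc ++ (nodes K L).reverse.map (upPair₁ K anc)

/-- The instructions of the circuit for a tree of depth `L + 1`. -/
def circuitOps (K : ℕ) (anc : ℕ → Fin A) (L : ℕ) : List (Op (Fin K ⊕ Fin A) ℕ) :=
  .merge (firstLayer K anc L) :: laterOps K anc L

/-- The instructions of the circuit, node by node. -/
def sequentialOps (K : ℕ) (anc : ℕ → Fin A) : List (Op (Fin K ⊕ Fin A) ℕ) :=
  [.merge (leafPairs K anc)] ++ ((List.range' 1 (K - 1)).reverse.flatMap (upNode K anc) ++
    (frameGates K anc ++ (rootOps K anc ++ (List.range' 1 (K - 1)).flatMap (downNode K anc))))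

variable {anc : ℕ → Fin A}

/-- The instructions `l` act on the ancillas `q`, read the bits `r` and write the bits `w`. -/
def Owned (K : ℕ) (anc : ℕ → Fin A) (q : ℕ → Prop) (r w : ℕ → ℕ → Prop)
    (l : List (Op (Fin K ⊕ Fin A) ℕ)) : Prop :=
  ∀ o ∈ l, (∀ x ∈ o.qubits, ∃ n, x = .inr (anc n) ∧ q n) ∧
    (∀ b ∈ o.reads, ∃ s i, b = bit s i ∧ r s i) ∧ ∀ b ∈ o.writes, ∃ s i, b = bit s i ∧ w s i

/-- Injectivity of `anc` and of `bit` turns every conflict of qubits or bits into a conflict of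
indices, which `omega` can refute. -/
theorem Owned.indep (hanc : Set.InjOn anc (Set.Iio (4 * K))) {q q' : ℕ → Prop}
    {r w r' w' : ℕ → ℕ → Prop} {l l' : List (Op (Fin K ⊕ Fin A) ℕ)} (h : Owned K anc q r w l)
    (h' : Owned K anc q' r' w' l') (hq : ∀ n, q n → q' n → False)
    (hb : ∀ n, q n ∨ q' n → n < 4 * K)
    (hrw : ∀ s i, r s i → w' s i → False) (hwr : ∀ s i, w s i → r' s i → False)
    (hww : ∀ s i, w s i → w' s i → False) : ∀ o ∈ l, ∀ o' ∈ l', o.Indep o' := by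
  intro o ho o' ho'
  obtain ⟨h₁, h₂, h₃⟩ := h o ho
  obtain ⟨h₁', h₂', h₃'⟩ := h' o' ho'
  refine ⟨fun x hx hx' => ?_, fun b hb hb' => ?_, fun b hb hb' => ?_, fun b hb hb' => ?_⟩
  · obtain ⟨n, e, hn⟩ := h₁ x hx
    obtain ⟨n', e', hn'⟩ := h₁' x hx'
    have := hanc (hb n (.inl hn)) (hb n' (.inr hn')) (Sum.inr_injective (e.symm.trans e'))
    exact hq n hn (this ▸ hn')
  · obtain ⟨s, i, e, hn⟩ := h₂ b hb
    obtain ⟨s', i', e', hn'⟩ := h₃' b hb'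
    obtain ⟨rfl, rfl⟩ := bit_inj.1 (e.symm.trans e')
    exact hrw _ _ hn hn'
  · obtain ⟨s, i, e, hn⟩ := h₃ b hb
    obtain ⟨s', i', e', hn'⟩ := h₂' b hb'
    obtain ⟨rfl, rfl⟩ := bit_inj.1 (e.symm.trans e')
    exact hwr _ _ hn hn'
  · obtain ⟨s, i, e, hn⟩ := h₃ b hb
    obtain ⟨s', i', e', hn'⟩ := h₃' b hb'
    obtain ⟨rfl, rfl⟩ := bit_inj.1 (e.symm.trans e')
    exact hww _ _ hn hn'

theorem upNode_owned (K : ℕ) (anc : ℕ → Fin A) (j : ℕ) :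
    Owned K anc
      (fun n => n = j ∨ n = 2 * j ∨ n = 2 * j + 1 ∨ n = 2 * K + 2 * j ∨ n = 2 * K + (2 * j + 1))
      (fun s i => s = 13 ∨ (i = j ∧ (s = 1 ∨ s = 2 ∨ s = 7 ∨ s = 8)) ∨
        ((i = 2 * j ∨ i = 2 * j + 1) ∧ (s = 0 ∨ (3 ≤ s ∧ s ≤ 6))))
      (fun s i => (i = j ∧ (s = 0 ∨ s = 1 ∨ s = 2 ∨ s = 7 ∨ s = 8)) ∨
        ((i = 2 * j ∨ i = 2 * j + 1) ∧ (3 ≤ s ∧ s ≤ 6))) (upNode K anc j) := by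
  intro o ho
  simp only [upNode, upRest₁, upRest₂, upRest₃, upEraseC, upEraseE, eraseRest, upLogic, upPair₁,
    upPair₂, upPairs₃, erasePair, List.mem_append, List.mem_cons, List.not_mem_nil, or_false] at ho
  rcases ho with (((((rfl | rfl) | rfl) | rfl | rfl) | rfl) |
    (((rfl | rfl | rfl | rfl) | rfl | rfl | rfl | rfl) | rfl | rfl | rfl)) <;>
    refine ⟨?_, ?_, ?_⟩ <;>
    simp only [Op.qubits, Op.reads, Op.writes, List.flatMap_cons, List.flatMap_nil, List.map_cons,
      List.map_nil, List.cons_append, List.nil_append, List.mem_cons, List.not_mem_nil, or_false,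
      forall_eq_or_imp, forall_eq, IsEmpty.forall_iff, implies_true, leg, car] <;>
    and_intros <;> first | exact ⟨_, rfl, by omega⟩ | exact ⟨_, _, rfl, by omega⟩

theorem downNode_owned (K : ℕ) (anc : ℕ → Fin A) (j : ℕ) :
    Owned K anc (fun n => n = 2 * j ∨ n = 2 * j + 1)
      (fun s i => i = j ∧ 9 ≤ s)
      (fun s i => (i = j ∧ 10 ≤ s) ∨ ((i = 2 * j ∨ i = 2 * j + 1) ∧ s = 9))
      (downNode K anc j) := by
  intro o ho
  simp only [downNode, downPair, downRest, eraseRest, erasePair, List.mem_append, List.mem_cons,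
    List.not_mem_nil, or_false] at ho
  rcases ho with (rfl | (rfl | rfl | rfl | rfl) | rfl) <;>
    refine ⟨?_, ?_, ?_⟩ <;>
    simp only [Op.qubits, Op.reads, Op.writes, List.flatMap_cons, List.flatMap_nil, List.map_cons,
      List.map_nil, List.cons_append, List.nil_append, List.mem_cons, List.not_mem_nil, or_false,
      forall_eq_or_imp, forall_eq, IsEmpty.forall_iff, implies_true, leg] <;>
    and_intros <;> first | exact ⟨_, rfl, by omega⟩ | exact ⟨_, _, rfl, by omega⟩

/-- A node touches only its own leg, those of its children and its own carriers; the two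
inequalities keep each node from being a child of the other. -/
theorem upNode_indep (hanc : Set.InjOn anc (Set.Iio (4 * K))) {i j : ℕ} (hi : i < K) (hj : j < K)
    (hne : i ≠ j) (hij : i < 2 * j) (hji : j < 2 * i) :
    ∀ o ∈ upNode K anc i, ∀ o' ∈ upNode K anc j, o.Indep o' :=
  (upNode_owned K anc i).indep hanc (upNode_owned K anc j) (by intros; omega) (by intros; omega)
    (by intros; omega) (by intros; omega) (by intros; omega)

theorem downNode_indep (hanc : Set.InjOn anc (Set.Iio (4 * K))) {i j : ℕ} (hi : i < K) (hj : j < K)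
    (hne : i ≠ j) (hij : i < 2 * j) (hji : j < 2 * i) :
    ∀ o ∈ downNode K anc i, ∀ o' ∈ downNode K anc j, o.Indep o' :=
  (downNode_owned K anc i).indep hanc (downNode_owned K anc j) (by intros; omega)
    (by intros; omega) (by intros; omega) (by intros; omega) (by intros; omega)

/-- The nodes `N` have the same depth, or at least none is a descendant of another one. -/
structure SameLevel (K : ℕ) (N : List ℕ) : Prop where
  nodup : N.Nodup
  lt : ∀ i ∈ N, i < K
  lt_two_mul : ∀ i ∈ N, ∀ j ∈ N, i < 2 * j

theorem sameLevel_nodes (K d : ℕ) : SameLevel K (nodes K d) :=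
  ⟨nodup_nodes K d, fun _ hi => (mem_nodes.1 hi).2.2, fun i hi j hj => by
    have h₁ := mem_nodes.1 hi
    have h₂ := mem_nodes.1 hj
    rw [pow_succ] at h₁
    omega⟩

theorem SameLevel.reverse {N : List ℕ} (h : SameLevel K N) : SameLevel K N.reverse :=
  ⟨List.nodup_reverse.2 h.nodup, fun i hi => h.lt i (List.mem_reverse.1 hi), fun i hi j hj =>
    h.lt_two_mul i (List.mem_reverse.1 hi) j (List.mem_reverse.1 hj)⟩

theorem upLevel_reorders (hanc : Set.InjOn anc (Set.Iio (4 * K))) {N : List ℕ}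
    (hN : SameLevel K N) : Reorders (upLevel K anc N) (N.flatMap (upNode K anc)) := by
  have h₁ : Reorders [Op.merge (N.map (upPair₁ K anc))]
      (N.flatMap fun j => [.merge [upPair₁ K anc j]]) := by
    rw [List.map_eq_flatMap]
    exact Reorders.merge_flatMap (by simp [upPair₁])
  have h₂ : Reorders [Op.merge (N.map (upPair₂ K anc))]
      (N.flatMap fun j => [.merge [upPair₂ K anc j]]) := by
    rw [List.map_eq_flatMap]
    exact Reorders.merge_flatMap (by simp [upPair₂])
  have h₃ : Reorders [Op.merge (N.flatMap (upPairs₃ K anc))]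
      (N.flatMap fun j => [.merge (upPairs₃ K anc j)]) :=
    Reorders.merge_flatMap (by simp [upPairs₃, erasePair])
  have h₄ := h₁.append ((Reorders.refl (N.flatMap (upRest₁ K anc))).append
    (h₂.append ((Reorders.refl (N.flatMap (upRest₂ K anc))).append
      (h₃.append (Reorders.refl (N.flatMap (upRest₃ K anc)))))))
  have h₅ := Reorders.layers hN.nodup [fun j => [.merge [upPair₁ K anc j]], upRest₁ K anc,
    fun j => [.merge [upPair₂ K anc j]], upRest₂ K anc, fun j => [.merge (upPairs₃ K anc j)],
    upRest₃ K anc] (by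
      intro i hi j hj hij f hf g hg o ho o' ho'
      refine upNode_indep hanc (hN.lt i hi) (hN.lt j hj) hij (hN.lt_two_mul i hi j hj)
        (hN.lt_two_mul j hj i hi) o ?_ o' ?_
      · simp only [List.mem_cons, List.not_mem_nil, or_false] at hf
        rcases hf with rfl | rfl | rfl | rfl | rfl | rfl <;>
          simp only [upNode, List.mem_append, ho, true_or, or_true]
      · simp only [List.mem_cons, List.not_mem_nil, or_false] at hg
        rcases hg with rfl | rfl | rfl | rfl | rfl | rfl <;>
          simp only [upNode, List.mem_append, ho', true_or, or_true])
  have h₆ : (fun j => upNode K anc j) = fun j => [fun j => [.merge [upPair₁ K anc j]],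
      upRest₁ K anc, fun j => [.merge [upPair₂ K anc j]], upRest₂ K anc,
      fun j => [.merge (upPairs₃ K anc j)], upRest₃ K anc].flatMap fun f => f j := by
    funext j
    simp [upNode]
  rw [← h₆] at h₅
  simp only [List.flatMap_cons, List.flatMap_nil, List.append_nil] at h₅
  exact h₄.trans h₅

theorem downLevel_reorders (hanc : Set.InjOn anc (Set.Iio (4 * K))) {N : List ℕ}
    (hN : SameLevel K N) : Reorders (downLevel K anc N) (N.flatMap (downNode K anc)) := by
  have h₁ : Reorders [Op.merge (N.map (downPair K anc))]
      (N.flatMap fun j => [.merge [downPair K anc j]]) := by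
    rw [List.map_eq_flatMap]
    exact Reorders.merge_flatMap (by simp [downPair, erasePair])
  refine (h₁.append (.refl (N.flatMap (downRest K anc)))).trans
    (Reorders.flatMap_append hN.nodup fun i hi j hj hij o ho o' ho' => ?_)
  refine downNode_indep hanc (hN.lt i hi) (hN.lt j hj) hij (hN.lt_two_mul i hi j hj)
    (hN.lt_two_mul j hj i hi) o ?_ o' ?_
  · rw [List.mem_singleton] at ho
    simp [downNode, ho]
  · simp [downNode, ho']

/-- The first layer splits into the data measurements and the first layer of the deepest level. The
levels together list 1, …, K-1; the descending order puts children before parents in the ascent, the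
ascending order puts parents first in the descent. -/
theorem circuitOps_reorders (hanc : Set.InjOn anc (Set.Iio (4 * K))) (hK : 1 ≤ K) {L : ℕ}
    (hL : K ≤ 2 ^ (L + 1)) : Reorders (circuitOps K anc L) (sequentialOps K anc) := by
  have h₁ : Reorders [Op.merge (firstLayer K anc L)]
      [.merge (leafPairs K anc), .merge ((nodes K L).reverse.map (upPair₁ K anc))] :=
    Reorders.merge_append (by simp [upPair₁, leafPairs, leafPair])
  have hU : (List.range' 1 (K - 1)).reverse.flatMap (upNode K anc) =
      (List.range (L + 1)).reverse.flatMap fun d => (nodes K d).reverse.flatMap (upNode K anc) := by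
    have := flatMap_nodes hK (L + 1)
    rw [min_eq_right hL] at this
    rw [← this, List.reverse_flatMap, List.flatMap_assoc]
    rfl
  have hD : (List.range' 1 (K - 1)).flatMap (downNode K anc) =
      (List.range (L + 1)).flatMap fun d => (nodes K d).flatMap (downNode K anc) := by
    have := flatMap_nodes hK (L + 1)
    rw [min_eq_right hL] at this
    rw [← this, List.flatMap_assoc]
  have h₂ : Reorders ((List.range (L + 1)).reverse.flatMap
      fun d => upLevel K anc (nodes K d).reverse)
      ((List.range' 1 (K - 1)).reverse.flatMap (upNode K anc)) := by
    rw [hU]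
    exact Reorders.flatMap _ fun d _ => upLevel_reorders hanc (sameLevel_nodes K d).reverse
  have h₃ : Reorders ((List.range (L + 1)).flatMap fun d => downLevel K anc (nodes K d))
      ((List.range' 1 (K - 1)).flatMap (downNode K anc)) := by
    rw [hD]
    exact Reorders.flatMap _ fun d _ => downLevel_reorders hanc (sameLevel_nodes K d)
  refine (h₁.append (.refl (laterOps K anc L))).trans ?_
  have h₄ := (Reorders.refl [Op.merge (leafPairs K anc)]).append (h₂.append
    ((Reorders.refl (frameGates K anc)).append ((Reorders.refl (rootOps K anc)).append h₃)))
  have h₅ : [Op.merge (leafPairs K anc), .merge ((nodes K L).reverse.map (upPair₁ K anc))] ++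
      laterOps K anc L = [.merge (leafPairs K anc)] ++ ((List.range (L + 1)).reverse.flatMap
        (fun d => upLevel K anc (nodes K d).reverse) ++ (frameGates K anc ++ (rootOps K anc ++
        (List.range (L + 1)).flatMap fun d => downLevel K anc (nodes K d)))) := by
    rw [List.range_succ, List.reverse_append, List.reverse_singleton]
    simp only [List.flatMap_cons, laterOps, upLevel, List.range_succ, List.cons_append, List.nil_append,
      List.append_assoc]
  rw [h₅]
  exact h₄

end Schedule

/-! ### Size and duration. -/

section Counting

variable {K A : ℕ} {anc : ℕ → Fin A}

theorem sum_map_flatMap {Q B : Type} (c : Op Q B → ℕ) {f : ℕ → List (Op Q B)} {k : ℕ}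
    (h : ∀ j, ((f j).map c).sum = k) (N : List ℕ) :
    ((N.flatMap f).map c).sum = N.length * k := by
  induction N with
  | nil => simp
  | cons j N ih =>
    rw [List.flatMap_cons, List.map_append, List.sum_append, h, ih, List.length_cons]
    ring

theorem circuitOps_size (hanc : Set.InjOn anc (Set.Iio (4 * K))) (hK : 1 ≤ K) {L : ℕ}
    (hL : K ≤ 2 ^ (L + 1)) : ((circuitOps K anc L).map Op.size).sum ≤ 27 * K := by
  -- The total is (18 + 6)(K-1) for the nodes, K for the leaves, 2K-1 for the frame gates and 2 at
  -- the root.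
  rw [(circuitOps_reorders hanc hK hL).size]
  have h₁ : ∀ j, ((upNode K anc j).map Op.size).sum = 18 := fun j => by
    simp [upNode, upRest₁, upRest₂, upRest₃, upEraseC, upEraseE, eraseRest, upLogic, upPairs₃,
      Op.size]
  have h₂ : ∀ j, ((downNode K anc j).map Op.size).sum = 6 := fun j => by
    simp [downNode, downRest, eraseRest, Op.size]
  have h₃ : ((frameGates K anc).map Op.size).sum = 2 * K - 1 := by
    have : (Op.size ∘ fun j => (.gate .X (leg K anc j) (bit 0 j) : Op (Fin K ⊕ Fin A) ℕ)) =
      fun _ => 1 := rfl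
    rw [frameGates, List.map_map, this]
    simp
  simp only [sequentialOps, List.map_append, List.sum_append, sum_map_flatMap _ h₁,
    sum_map_flatMap _ h₂, h₃]
  simp [rootOps, leafPairs, Op.size]
  omega

/-- A level costs three cycles in the ascent and one in the descent. The data layer costs nothing
extra because it shares its cycle with the first measurements of the deepest level. -/
theorem circuitOps_cycles (nP L : ℕ) :
    ((circuitOps K anc L).map (Op.cycles nP)).sum = nP + 4 * (L + 1) := by
  have h₁ : ∀ N : List ℕ, ((N.flatMap (upRest₁ K anc)).map (Op.cycles nP)).sum = 0 := fun N =>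
    sum_map_flatMap (f := upRest₁ K anc) (k := 0) (Op.cycles nP) (fun j => rfl) N
  have h₂ : ∀ N : List ℕ, ((N.flatMap (upRest₂ K anc)).map (Op.cycles nP)).sum = 0 := fun N =>
    sum_map_flatMap (f := upRest₂ K anc) (k := 0) (Op.cycles nP) (fun j => rfl) N
  have h₃ : ∀ N : List ℕ, ((N.flatMap (upRest₃ K anc)).map (Op.cycles nP)).sum = 0 := fun N =>
    sum_map_flatMap (f := upRest₃ K anc) (k := 0) (Op.cycles nP) (fun j => rfl) N
  have h₄ : ∀ N : List ℕ, ((N.flatMap (downRest K anc)).map (Op.cycles nP)).sum = 0 := fun N =>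
    sum_map_flatMap (f := downRest K anc) (k := 0) (Op.cycles nP) (fun j => rfl) N
  have h₅ : ∀ N : List ℕ, ((upLevelRest K anc N).map (Op.cycles nP)).sum = 2 := fun N => by
    simp [upLevelRest, h₁, h₂, h₃, Op.cycles]
  have h₆ : ∀ N : List ℕ, ((upLevel K anc N).map (Op.cycles nP)).sum = 3 := fun N => by
    simp [upLevel, h₅, Op.cycles]
  have h₇ : ∀ N : List ℕ, ((downLevel K anc N).map (Op.cycles nP)).sum = 1 := fun N => by
    simp [downLevel, h₄, Op.cycles]
  have h₈ : ((frameGates K anc).map (Op.cycles nP)).sum = 0 := by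
    have : (Op.cycles nP ∘ fun j => (.gate .X (leg K anc j) (bit 0 j) : Op (Fin K ⊕ Fin A) ℕ)) =
      fun _ => 0 := rfl
    rw [frameGates, List.map_map, this]
    simp
  have h₉ : ((rootOps K anc).map (Op.cycles nP)).sum = nP := rfl
  simp only [circuitOps, laterOps, List.map_cons, List.sum_cons, List.map_append, List.sum_append,
    h₅, h₈, h₉, sum_map_flatMap _ (fun d => h₆ (nodes K d).reverse),
    sum_map_flatMap _ (fun d => h₇ (nodes K d)), Op.cycles, List.length_reverse, List.length_range]
  ring

theorem merge_qubits_nodup {Q B : Type} [DecidableEq Q] [DecidableEq B] {N : List ℕ}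
    (hN : N.Nodup) {g : ℕ → List (PairMeas Q B)} (h : ∀ i ∈ N, (Op.merge (g i)).qubits.Nodup)
    (h' : ∀ i ∈ N, ∀ j ∈ N, i ≠ j → (Op.merge (g i)).Indep (Op.merge (g j))) :
    (Op.merge (N.flatMap g)).qubits.Nodup := by
  have : (Op.merge (N.flatMap g)).qubits = N.flatMap fun j => (Op.merge (g j)).qubits := by
    simp only [Op.qubits, List.flatMap_assoc]
  rw [this, List.nodup_flatMap]
  refine ⟨h, hN.imp_of_mem fun {i j} hi hj hij => ?_⟩
  exact fun q hq hq' => (h' i hi j hj hij).qubits q hq hq'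

end Counting

/-! ### Disjoint measurements, untouched data qubits, bits written once. -/

section WellFormed

variable {K A : ℕ} {anc : ℕ → Fin A}

theorem firstLayer_qubits_nodup (hanc : Set.InjOn anc (Set.Iio (4 * K))) (L : ℕ) :
    (Op.merge (firstLayer K anc L)).qubits.Nodup := by
  have e : ∀ i i', i < 4 * K → i' < 4 * K → i ≠ i' →
    (Sum.inr (anc i) : Fin K ⊕ Fin A) ≠ Sum.inr (anc i') := fun i i' => inr_anc_ne hanc
  simp only [Op.qubits, firstLayer, leafPairs, List.flatMap_append, List.flatMap_map]
  refine List.Nodup.append ?_ ?_ ?_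
  · rw [List.nodup_flatMap]
    refine ⟨fun i _ => by simp [leafPair, leg], (List.nodup_finRange K).imp_of_mem ?_⟩
    intro i j _ _ hij q hq hq'
    have hij' : (i : ℕ) ≠ j := fun h => hij (Fin.ext h)
    simp only [leafPair, leg, List.mem_cons, List.not_mem_nil, or_false] at hq hq'
    rcases hq with rfl | rfl <;> rcases hq' with hq' | hq'
    · exact hij (Sum.inl_injective hq')
    · cases hq'
    · cases hq'
    · exact e (K + i) (K + j) (by omega) (by omega) (by omega) hq'
  · rw [List.nodup_flatMap]
    refine ⟨fun i hi => ?_, (nodup_nodes K L).reverse.imp_of_mem ?_⟩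
    · have := mem_nodes.1 (List.mem_reverse.1 hi)
      simp only [upPair₁, List.nodup_cons, List.mem_singleton, List.not_mem_nil, not_false_eq_true,
        List.nodup_nil, and_self, and_true]
      apply e <;> omega
    intro i j hi hj hij q hq hq'
    have := mem_nodes.1 (List.mem_reverse.1 hi)
    have := mem_nodes.1 (List.mem_reverse.1 hj)
    simp only [upPair₁, leg, car, List.mem_cons, List.not_mem_nil, or_false] at hq hq'
    rcases hq with rfl | rfl <;> rcases hq' with hq' | hq' <;> revert hq' <;> apply e <;> omega
  · intro q hq hq'
    obtain ⟨i, _, hq⟩ := List.mem_flatMap.1 hq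
    obtain ⟨j, hj, hq'⟩ := List.mem_flatMap.1 hq'
    have := mem_nodes.1 (List.mem_reverse.1 hj)
    simp only [upPair₁, leafPair, leg, car, List.mem_cons, List.not_mem_nil, or_false] at hq hq'
    rcases hq with rfl | rfl <;> rcases hq' with hq' | hq'
    · cases hq'
    · cases hq'
    · revert hq'; apply e <;> omega
    · revert hq'; apply e <;> omega

theorem upPair₂_qubits_nodup (hanc : Set.InjOn anc (Set.Iio (4 * K))) {N : List ℕ}
    (hN : SameLevel K N) : (Op.merge (N.map (upPair₂ K anc))).qubits.Nodup := by
  rw [List.map_eq_flatMap]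
  refine merge_qubits_nodup hN.nodup (fun i hi => ?_) fun i hi j hj hij =>
    upNode_indep hanc (hN.lt i hi) (hN.lt j hj) hij (hN.lt_two_mul i hi j hj)
      (hN.lt_two_mul j hj i hi) _ (by simp [upNode]) _ (by simp [upNode])
  have := hN.lt i hi
  simp only [Op.qubits, upPair₂, List.flatMap_singleton, List.nodup_cons, List.mem_singleton,
    List.not_mem_nil, not_false_eq_true, List.nodup_nil, and_self, and_true]
  apply inr_anc_ne hanc <;> omega

theorem upPairs₃_qubits_nodup (hanc : Set.InjOn anc (Set.Iio (4 * K))) {N : List ℕ}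
    (hN : SameLevel K N) : (Op.merge (N.flatMap (upPairs₃ K anc))).qubits.Nodup := by
  refine merge_qubits_nodup hN.nodup (fun i hi => ?_) fun i hi j hj hij =>
    upNode_indep hanc (hN.lt i hi) (hN.lt j hj) hij (hN.lt_two_mul i hi j hj)
      (hN.lt_two_mul j hj i hi) _ (by simp [upNode]) _ (by simp [upNode])
  have := hN.lt i hi
  simp only [Op.qubits, upPairs₃, erasePair, List.flatMap_cons, List.flatMap_nil,
    List.append_nil, List.cons_append, List.nil_append, List.nodup_cons, List.mem_cons,
    List.not_mem_nil, not_false_eq_true, List.nodup_nil, and_true, or_false, not_or]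
  and_intros <;> apply inr_anc_ne hanc <;> omega

theorem downPair_qubits_nodup (hanc : Set.InjOn anc (Set.Iio (4 * K))) {N : List ℕ}
    (hN : SameLevel K N) : (Op.merge (N.map (downPair K anc))).qubits.Nodup := by
  rw [List.map_eq_flatMap]
  refine merge_qubits_nodup hN.nodup (fun i hi => ?_) fun i hi j hj hij =>
    downNode_indep hanc (hN.lt i hi) (hN.lt j hj) hij (hN.lt_two_mul i hi j hj)
      (hN.lt_two_mul j hj i hi) _ (by simp [downNode]) _ (by simp [downNode])
  have := hN.lt i hi
  simp only [Op.qubits, downPair, erasePair, List.flatMap_singleton, List.nodup_cons,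
    List.mem_singleton, List.not_mem_nil, not_false_eq_true, List.nodup_nil, and_self, and_true]
  apply inr_anc_ne hanc <;> omega

theorem circuitOps_merge_nodup (hanc : Set.InjOn anc (Set.Iio (4 * K))) (L : ℕ) :
    ∀ ms, Op.merge ms ∈ circuitOps K anc L → (Op.merge ms).qubits.Nodup := by
  intro ms hms
  have h₁ : ∀ j, Op.merge ms ∉ upRest₁ K anc j := by simp [upRest₁]
  have h₂ : ∀ j, Op.merge ms ∉ upRest₂ K anc j := by simp [upRest₂]
  have h₃ : ∀ j, Op.merge ms ∉ upRest₃ K anc j := by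
    simp [upRest₃, upEraseC, upEraseE, eraseRest, upLogic]
  have h₄ : ∀ j, Op.merge ms ∉ downRest K anc j := by simp [downRest, eraseRest]
  have h₅ : Op.merge ms ∉ frameGates K anc := by simp [frameGates]
  have h₆ : Op.merge ms ∉ rootOps K anc := by simp [rootOps]
  have hrest : ∀ d, Op.merge ms ∈ upLevelRest K anc (nodes K d).reverse →
      (Op.merge ms).qubits.Nodup := by
    intro d hd
    simp only [upLevelRest, List.mem_append, List.mem_cons, List.mem_flatMap, h₁, h₂, h₃,
      and_false, exists_false, false_or, or_false] at hd
    rcases hd with hd | hd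
    · rw [hd]
      exact upPair₂_qubits_nodup hanc (sameLevel_nodes K d).reverse
    · rw [hd]
      exact upPairs₃_qubits_nodup hanc (sameLevel_nodes K d).reverse
  simp only [circuitOps, laterOps, List.mem_append, List.mem_cons, h₅, h₆, false_or,
    List.mem_flatMap (l := (List.range L).reverse), List.mem_flatMap (l := List.range (L + 1))]
    at hms
  rcases hms with hms | hms | ⟨d, _, hms⟩ | ⟨d, _, hms⟩
  · rw [hms]
    exact firstLayer_qubits_nodup hanc L
  · exact hrest L hms
  · rcases List.mem_cons.1 hms with hms | hms
    · rw [hms, List.map_eq_flatMap]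
      have hN := (sameLevel_nodes K d).reverse
      refine merge_qubits_nodup hN.nodup (fun i hi => ?_) fun i hi j hj hij =>
        upNode_indep hanc (hN.lt i hi) (hN.lt j hj) hij (hN.lt_two_mul i hi j hj)
          (hN.lt_two_mul j hj i hi) _ (by simp [upNode]) _ (by simp [upNode])
      have := hN.lt i hi
      simp only [Op.qubits, upPair₁, List.flatMap_singleton, List.nodup_cons, List.mem_singleton,
        List.not_mem_nil, not_false_eq_true, List.nodup_nil, and_self, and_true]
      apply inr_anc_ne hanc <;> omega
    · exact hrest d hms
  · rcases List.mem_cons.1 hms with hms | hms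
    · rw [hms]
      exact downPair_qubits_nodup hanc (sameLevel_nodes K d)
    · simp only [List.mem_flatMap, h₄, and_false, exists_false] at hms

theorem Owned.inl_notMem {q : ℕ → Prop} {r w : ℕ → ℕ → Prop}
    {l : List (Op (Fin K ⊕ Fin A) ℕ)} (h : Owned K anc q r w l) {o : Op (Fin K ⊕ Fin A) ℕ}
    (ho : o ∈ l) (i : Fin K) : Sum.inl i ∉ o.qubits := fun hi => by
  obtain ⟨n, hn, _⟩ := (h o ho).1 _ hi
  cases hn

theorem merge_inl_notMem {N : List ℕ} {g : ℕ → List (PairMeas (Fin K ⊕ Fin A) ℕ)} {i : Fin K}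
    (h : ∀ j ∈ N, Sum.inl i ∉ (Op.merge (g j)).qubits) :
    Sum.inl i ∉ (Op.merge (N.flatMap g)).qubits := by
  have : (Op.merge (N.flatMap g)).qubits = N.flatMap fun j => (Op.merge (g j)).qubits := by
    simp only [Op.qubits, List.flatMap_assoc]
  rw [this, List.mem_flatMap]
  rintro ⟨j, hj, hi⟩
  exact h j hj hi

theorem laterOps_inl_notMem (L : ℕ) :
    ∀ o ∈ laterOps K anc L, ∀ i : Fin K, Sum.inl i ∉ o.qubits := by
  intro o ho i
  have hup : ∀ j, ∀ o' ∈ upNode K anc j, Sum.inl i ∉ o'.qubits := fun j o' ho' =>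
    (upNode_owned K anc j).inl_notMem ho' i
  have hdown : ∀ j, ∀ o' ∈ downNode K anc j, Sum.inl i ∉ o'.qubits := fun j o' ho' =>
    (downNode_owned K anc j).inl_notMem ho' i
  have hrest : ∀ N, o ∈ upLevelRest K anc N → Sum.inl i ∉ o.qubits := by
    intro N hN
    simp only [upLevelRest, List.mem_append, List.mem_cons, List.mem_flatMap] at hN
    rcases hN with ⟨j, _, hj⟩ | rfl | ⟨j, _, hj⟩ | rfl | ⟨j, _, hj⟩
    · exact hup j o (by simp [upNode, hj])
    · rw [List.map_eq_flatMap]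
      exact merge_inl_notMem fun j _ => hup j _ (by simp [upNode])
    · exact hup j o (by simp [upNode, hj])
    · exact merge_inl_notMem fun j _ => hup j _ (by simp [upNode])
    · exact hup j o (by simp [upNode, hj])
  simp only [laterOps, List.mem_append, List.mem_flatMap (l := (List.range L).reverse),
    List.mem_flatMap (l := List.range (L + 1))] at ho
  rcases ho with ho | ⟨d, _, ho⟩ | ho | ho | ⟨d, _, ho⟩
  · exact hrest _ ho
  · rcases List.mem_cons.1 ho with rfl | ho
    · rw [List.map_eq_flatMap]
      exact merge_inl_notMem fun j _ => hup j _ (by simp [upNode])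
    · exact hrest _ ho
  · obtain ⟨j, _, rfl⟩ := List.mem_map.1 ho
    simp [Op.qubits, leg]
  · simp only [rootOps, List.mem_cons, List.not_mem_nil, or_false] at ho
    rcases ho with rfl | rfl <;> simp [Op.qubits, leg]
  · rcases List.mem_cons.1 ho with rfl | ho
    · rw [List.map_eq_flatMap]
      exact merge_inl_notMem fun j _ => hdown j _ (by simp [downNode])
    · obtain ⟨j, _, hj⟩ := List.mem_flatMap.1 ho
      exact hdown j o (by simp [downNode, hj])

theorem Owned.of_mem_writes {q : ℕ → Prop} {r w : ℕ → ℕ → Prop}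
    {l : List (Op (Fin K ⊕ Fin A) ℕ)} (h : Owned K anc q r w l) {b : ℕ}
    (hb : b ∈ l.flatMap Op.writes) : ∃ s i, b = bit s i ∧ w s i := by
  obtain ⟨o, ho, hb⟩ := List.mem_flatMap.1 hb
  exact (h o ho).2.2 b hb

/-- Rescheduling permutes the written bits, so the sequential order suffices. Kind 0 is written by
the leaf or the node itself, kind 9 by the parent (by the root measurement for node 1). -/
theorem circuitOps_writes_nodup (hanc : Set.InjOn anc (Set.Iio (4 * K))) (hK : 1 ≤ K) {L : ℕ}
    (hL : K ≤ 2 ^ (L + 1)) : ((circuitOps K anc L).flatMap Op.writes).Nodup := by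
  rw [(circuitOps_reorders hanc hK hL).writes.nodup_iff]
  have hframe : (frameGates K anc).flatMap Op.writes = [] := by
    rw [List.flatMap_eq_nil_iff]
    intro o ho
    obtain ⟨j, _, rfl⟩ := List.mem_map.1 ho
    rfl
  have hroot : (rootOps K anc).flatMap Op.writes = [bit 9 1] := rfl
  have hleaf : [Op.merge (leafPairs K anc)].flatMap Op.writes =
      (List.finRange K).map fun i : Fin K => bit 0 (K + i) := by
    simp [Op.writes, leafPairs, leafPair]
  simp only [sequentialOps, List.flatMap_append, hframe, hroot, hleaf, List.flatMap_assoc,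
    List.nil_append]
  have hup := fun j (b : ℕ) => (upNode_owned K anc j).of_mem_writes (b := b)
  have hdown := fun j (b : ℕ) => (downNode_owned K anc j).of_mem_writes (b := b)
  refine List.Nodup.append ?_ (List.Nodup.append ?_ (List.Nodup.append (by simp) ?_ ?_) ?_) ?_
  · refine (List.nodup_finRange K).map fun i j h => ?_
    simp only [bit_inj, true_and] at h
    exact Fin.ext (by omega)
  · rw [List.nodup_flatMap]
    refine ⟨fun j hj => ?_, (List.nodup_range' (s := 1) (n := K - 1)).reverse.imp_of_mem ?_⟩
    · simp [upNode, upRest₁, upRest₂, upRest₃, upEraseC, upEraseE, eraseRest, upLogic, upPair₁,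
        upPair₂, upPairs₃, erasePair, Op.writes]
    · intro i j _ _ hij b hb hb'
      obtain ⟨s, n, rfl, h⟩ := hup i b hb
      obtain ⟨s', n', e, h'⟩ := hup j _ hb'
      obtain ⟨rfl, rfl⟩ := bit_inj.1 e
      omega
  · rw [List.nodup_flatMap]
    refine ⟨fun j hj => ?_, (List.nodup_range' (s := 1) (n := K - 1)).imp_of_mem ?_⟩
    · simp [downNode, downRest, downPair, eraseRest, erasePair, Op.writes]
    · intro i j _ _ hij b hb hb'
      obtain ⟨s, n, rfl, h⟩ := hdown i b hb
      obtain ⟨s', n', e, h'⟩ := hdown j _ hb'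
      obtain ⟨rfl, rfl⟩ := bit_inj.1 e
      omega
  · intro b hb hb'
    obtain ⟨j, hj, hb'⟩ := List.mem_flatMap.1 hb'
    obtain ⟨s, n, e, h⟩ := hdown j b hb'
    rw [List.mem_singleton.1 hb, bit_inj] at e
    have := (List.mem_range'_1.1 hj).1
    omega
  · intro b hb hb'
    obtain ⟨i, hi, hb⟩ := List.mem_flatMap.1 hb
    obtain ⟨s, n, rfl, h⟩ := hup i b hb
    rcases List.mem_append.1 hb' with hb' | hb'
    · rw [List.mem_singleton, bit_inj] at hb'
      omega
    · obtain ⟨j, hj, hb'⟩ := List.mem_flatMap.1 hb'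
      obtain ⟨s', n', e, h'⟩ := hdown j _ hb'
      rw [bit_inj] at e
      omega
  · intro b hb hb'
    obtain ⟨i, _, rfl⟩ := List.mem_map.1 hb
    rcases List.mem_append.1 hb' with hb' | hb'
    · obtain ⟨j, hj, hb'⟩ := List.mem_flatMap.1 hb'
      obtain ⟨s', n', e, h'⟩ := hup j _ hb'
      rw [List.mem_reverse, List.mem_range'_1] at hj
      rw [bit_inj] at e
      omega
    rcases List.mem_append.1 hb' with hb' | hb'
    · rw [List.mem_singleton, bit_inj] at hb'
      omega
    · obtain ⟨j, hj, hb'⟩ := List.mem_flatMap.1 hb'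
      obtain ⟨s', n', e, h'⟩ := hdown j _ hb'
      rw [bit_inj] at e
      omega

end WellFormed

/-! ### Invariants of the state during ascent, phase gate and descent. -/

section Invariants

variable {K A : ℕ} {anc : ℕ → Fin A}

/-- The value of the node `j` of the tree if the data qubits have the values `x`: that of the data
qubit at a leaf, and the conjunction of the values of its children at an internal node. -/
def val (x : Fin K → Bool) (j : ℕ) : Bool :=
  if 1 ≤ j ∧ j < K then val x (2 * j) && val x (2 * j + 1)
  -- The default `true` makes `val_true` hold at every index.
  else if h : j - K < K then x ⟨j - K, h⟩ else true
termination_by K - j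

theorem val_node (x : Fin K → Bool) {j : ℕ} (hj : 1 ≤ j) (hjK : j < K) :
    val x j = (val x (2 * j) && val x (2 * j + 1)) := by
  rw [val, if_pos ⟨hj, hjK⟩]

theorem val_leaf (x : Fin K → Bool) (i : Fin K) : val x (K + i) = x i := by
  rw [val, if_neg (by omega), dif_pos (by omega)]
  congr 1
  ext
  simp

theorem val_true (j : ℕ) : val (fun _ : Fin K => true) j = true := by
  fun_induction val (fun _ : Fin K => true) j with
  | case1 j h ih₁ ih₂ => simp [ih₁, ih₂]
  | case2 => rfl
  | case3 => rfl

/-- Truth of a conjunction passes from each node to its children, hence from the root to every leaf.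
-/
theorem val_one (hK : 1 ≤ K) (x : Fin K → Bool) : val x 1 = true ↔ x = fun _ => true := by
  refine ⟨fun h => funext fun i => ?_, fun h => by rw [h, val_true]⟩
  have key : ∀ j, 1 ≤ j → j < 2 * K → val x j = true := by
    intro j
    induction j using Nat.strong_induction_on with
    | _ j ih =>
      intro hj hjK
      rcases Nat.lt_or_ge j 2 with h2 | h2
      · rwa [show j = 1 by omega]
      · have hp := ih (j / 2) (by omega) (by omega) (by omega)
        rw [val_node x (by omega) (by omega), Bool.and_eq_true] at hp
        rcases Nat.mod_two_eq_zero_or_one j with h | h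
        · rw [show j = 2 * (j / 2) by omega]
          exact hp.1
        · rw [show j = 2 * (j / 2) + 1 by omega]
          exact hp.2
  rw [← val_leaf x i]
  exact key _ (by omega) (by omega)

/-- The values of the data qubits. -/
def dataOf (z : Fin K ⊕ Fin A → Bool) : Fin K → Bool := fun i => z (.inl i)

/-- The values of the ancilla qubits. -/
def ancOf (z : Fin K ⊕ Fin A → Bool) : Fin A → Bool := fun a => z (.inr a)

theorem dataOf_update (z : Fin K ⊕ Fin A → Bool) (a : Fin A) (v : Bool) :
    dataOf (Function.update z (.inr a) v) = dataOf z :=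
  funext fun i => Function.update_of_ne (by simp) _ _

theorem ancOf_update (z : Fin K ⊕ Fin A → Bool) (a : Fin A) (v : Bool) :
    ancOf (Function.update z (.inr a) v) = Function.update (ancOf z) a v :=
  Function.update_comp_eq_of_injective z Sum.inr_injective a v

/-- The function `R` does not depend on the ancillas with numbers in `P`. -/
def FreeOf (anc : ℕ → Fin A) (R : State (Fin A)) (P : ℕ → Prop) : Prop :=
  ∀ n, P n → ∀ y v, R (Function.update y (anc n) v) = R y

theorem FreeOf.ancOf {R : State (Fin A)} {P : ℕ → Prop} (h : FreeOf anc R P) {n : ℕ} (hn : P n)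
    (z : Fin K ⊕ Fin A → Bool) (v : Bool) :
    R (ancOf (Function.update z (.inr (anc n)) v)) = R (ancOf z) := by
  rw [ancOf_update, h n hn]

/-- The indicator function that the carrier of `j` has the value of `j`, flipped if `f`. -/
noncomputable def legDelta (K : ℕ) (anc : ℕ → Fin A) (f : ℕ → Bool) (j : ℕ)
    (z : Fin K ⊕ Fin A → Bool) : ℂ :=
  if z (leg K anc j) = xor (val (dataOf z) j) (f j) then 1 else 0

theorem legDelta_congr {f f' : ℕ → Bool} {j : ℕ} (h : f j = f' j) (z : Fin K ⊕ Fin A → Bool) :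
    legDelta K anc f j z = legDelta K anc f' j z := by
  rw [legDelta, legDelta, h]

theorem legDelta_update (hanc : Set.InjOn anc (Set.Iio (4 * K))) (f : ℕ → Bool) {j n : ℕ}
    (hj : j < 4 * K) (hn : n < 4 * K) (h : j ≠ n) (z : Fin K ⊕ Fin A → Bool) (v : Bool) :
    legDelta K anc f j (Function.update z (.inr (anc n)) v) = legDelta K anc f j z := by
  rw [legDelta, legDelta, dataOf_update, leg, Function.update_of_ne (inr_anc_ne hanc hj hn h)]

theorem nodeAmp_update (hanc : Set.InjOn anc (Set.Iio (4 * K))) {j n : ℕ}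
    (hj : j < K) (hn : n < 4 * K) (h₁ : n ≠ 2 * j) (h₂ : n ≠ 2 * j + 1)
    (h₃ : n ≠ 2 * K + 2 * j) (h₄ : n ≠ 2 * K + (2 * j + 1))
    (z : Fin K ⊕ Fin A → Bool) (v : Bool) :
    nodeAmp K anc j (Function.update z (.inr (anc n)) v) = nodeAmp K anc j z := by
  rw [nodeAmp, nodeAmp, leg, leg, car, car, Function.update_of_ne, Function.update_of_ne,
    Function.update_of_ne, Function.update_of_ne] <;> apply inr_anc_ne hanc <;> omega

/-- The state after the computation of the values of all nodes from `i` on. -/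
noncomputable def upState (anc : ℕ → Fin A) (ψ : State (Fin K)) (R : State (Fin A))
    (f : ℕ → Bool) (i : ℕ) : State (Fin K ⊕ Fin A) := fun z =>
  ψ (dataOf z) * R (ancOf z) * (∏ j ∈ Finset.Ico i (2 * K), legDelta K anc f j z) *
    ∏ j ∈ Finset.Ico 1 i, nodeAmp K anc j z

/-- The CCZ factor of `j` is traded for the constraint on its leg. What the erased carriers retain
goes into `R'`, which, like `m'`, is chosen before `ψ`. -/
theorem upState_step (γ : ℝ) (ω m : ℕ → Bool) (hanc : Set.InjOn anc (Set.Iio (4 * K))) {j : ℕ}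
    (hj : 1 ≤ j) (hjK : j < K) (R : State (Fin A))
    (hm : ∀ s u, (3 ≤ s ∧ s ≤ 5 ∧ u < 2 * (j + 1)) ∨ 9 ≤ s → m (bit s u) = false)
    (hR : FreeOf anc R fun n => (1 ≤ n ∧ n < 2 * K) ∨ (2 * K + 2 ≤ n ∧ n < 2 * K + 2 * (j + 1))) :
    ∃ (R' : State (Fin A)) (m' : ℕ → Bool),
      (∀ s u, (3 ≤ s ∧ s ≤ 5 ∧ u < 2 * j) ∨ 9 ≤ s → m' (bit s u) = false) ∧
      (FreeOf anc R' fun n => (1 ≤ n ∧ n < 2 * K) ∨ (2 * K + 2 ≤ n ∧ n < 2 * K + 2 * j)) ∧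
      ∀ ψ : State (Fin K),
        runAll γ ω (upNode K anc j) (upState anc ψ R (fun i => m (bit 0 i)) (j + 1), m) =
          (upState anc ψ R' (fun i => m' (bit 0 i)) j, m') := by
  obtain ⟨χ, m', hm', hrun⟩ := upNode_run γ ω m hanc hj hjK fun s u h₁ h₂ h₃ =>
    hm s u (by omega)
  refine ⟨fun y => R y * χ (y (anc (2 * K + 2 * j))) (y (anc (2 * K + (2 * j + 1)))), m', ?_, ?_,
    fun ψ => ?_⟩
  · intro s u h
    rw [hm' s u (by omega), hm s u (by omega)]
  · intro n hn y v
    change R _ * χ _ _ = _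
    rw [hR n (by omega), Function.update_of_ne, Function.update_of_ne]
    · exact fun e => absurd (hanc (Set.mem_Iio.2 (by omega)) (Set.mem_Iio.2 (by omega)) e)
        (by omega)
    · exact fun e => absurd (hanc (Set.mem_Iio.2 (by omega)) (Set.mem_Iio.2 (by omega)) e)
        (by omega)
  set E : State (Fin K ⊕ Fin A) := fun z => ψ (dataOf z) * R (ancOf z) *
    (∏ i ∈ Finset.Ico (j + 1) (2 * K), legDelta K anc (fun i => m (bit 0 i)) i z) *
      ∏ i ∈ Finset.Ico 1 j, nodeAmp K anc i z with hE
  have hfree : ∀ n, n = 2 * K + 2 * j ∨ n = 2 * K + (2 * j + 1) → ∀ z v,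
      E (Function.update z (.inr (anc n)) v) = E z := by
    intro n hn z v
    simp only [hE]
    rw [dataOf_update, hR.ancOf (by omega)]
    congr 1
    · congr 1
      refine Finset.prod_congr rfl fun i hi => ?_
      rw [Finset.mem_Ico] at hi
      exact legDelta_update hanc _ (by omega) (by omega) (by omega) z v
    · refine Finset.prod_congr rfl fun i hi => ?_
      rw [Finset.mem_Ico] at hi
      exact nodeAmp_update hanc (by omega) (by omega) (by omega) (by omega) (by omega) (by omega)
        z v
  have h₁ : upState anc ψ R (fun i => m (bit 0 i)) (j + 1) = fun z => E z * nodeAmp K anc j z := by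
    funext z
    rw [upState, Finset.prod_Ico_succ_top hj, hE]
    ring
  rw [h₁, hrun E (hfree _ (.inl rfl)) (hfree _ (.inr rfl))]
  refine Prod.ext (funext fun z => ?_) rfl
  simp only [hE, upState, Finset.prod_eq_prod_Ico_succ_bot (show j < 2 * K by omega)]
  have h₂ : ∏ i ∈ Finset.Ico (j + 1) (2 * K), legDelta K anc (fun i => m' (bit 0 i)) i z =
      ∏ i ∈ Finset.Ico (j + 1) (2 * K), legDelta K anc (fun i => m (bit 0 i)) i z := by
    refine Finset.prod_congr rfl fun i hi => ?_
    rw [Finset.mem_Ico] at hi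
    rw [legDelta, legDelta, hm' 0 i (by omega)]
  rw [h₂]
  -- Only on the support of the later constraints do the unflipped legs of the children equal their
  -- values; elsewhere both sides vanish.
  by_cases h₃ : ∏ i ∈ Finset.Ico (j + 1) (2 * K), legDelta K anc (fun i => m (bit 0 i)) i z = 0
  · simp [h₃]
  have h₄ : ∀ i ∈ Finset.Ico (j + 1) (2 * K),
      xor (z (leg K anc i)) (m (bit 0 i)) = val (dataOf z) i := by
    intro i hi
    have := Finset.prod_ne_zero_iff.1 h₃ i hi
    rw [legDelta] at this
    have := (ite_ne_right_iff.1 this).1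
    rw [this, Bool.xor_assoc, Bool.xor_self, Bool.xor_false]
  rw [h₄ (2 * j) (Finset.mem_Ico.2 (by omega)), h₄ (2 * j + 1) (Finset.mem_Ico.2 (by omega)),
    ← val_node _ hj hjK]
  simp only [legDelta, ancOf, car]
  ring

theorem upState_run (γ : ℝ) (ω m : ℕ → Bool) (hanc : Set.InjOn anc (Set.Iio (4 * K)))
    (R : State (Fin A)) (hm : ∀ s u, 3 ≤ s → m (bit s u) = false)
    (hR : FreeOf anc R fun n => (1 ≤ n ∧ n < 2 * K) ∨ (2 * K + 2 ≤ n ∧ n < 2 * K + 2 * K))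
    {n : ℕ} (hn : n < K) :
    ∃ (R' : State (Fin A)) (m' : ℕ → Bool),
      (∀ s u, (3 ≤ s ∧ s ≤ 5 ∧ u < 2 * (K - n)) ∨ 9 ≤ s → m' (bit s u) = false) ∧
      (FreeOf anc R' fun i => (1 ≤ i ∧ i < 2 * K) ∨ (2 * K + 2 ≤ i ∧ i < 2 * K + 2 * (K - n))) ∧
      ∀ ψ : State (Fin K), runAll γ ω ((List.range' (K - n) n).reverse.flatMap (upNode K anc))
        (upState anc ψ R (fun i => m (bit 0 i)) K, m) =
          (upState anc ψ R' (fun i => m' (bit 0 i)) (K - n), m') := by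
  induction n with
  | zero => exact ⟨R, m, fun s u h => hm s u (by omega), hR, fun ψ => rfl⟩
  | succ n ih =>
    obtain ⟨R₁, m₁, hm₁, hR₁, hrun₁⟩ := ih (by omega)
    rw [show K - n = K - (n + 1) + 1 by omega] at hm₁ hR₁ hrun₁
    obtain ⟨R₂, m₂, hm₂, hR₂, hrun₂⟩ :=
      upState_step γ ω m₁ hanc (j := K - (n + 1)) (by omega) (by omega) R₁ hm₁ hR₁
    refine ⟨R₂, m₂, hm₂, hR₂, fun ψ => ?_⟩
    rw [List.range'_succ, List.reverse_cons, List.flatMap_append, runAll_append, hrun₁,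
      List.flatMap_singleton, hrun₂]

/-- After n gates exactly the flips of the nodes above n remain. -/
theorem frameGates_run (γ : ℝ) (ω m : ℕ → Bool) (hanc : Set.InjOn anc (Set.Iio (4 * K)))
    (ψ : State (Fin K)) (R : State (Fin A)) (hR : FreeOf anc R fun n => 1 ≤ n ∧ n < 2 * K)
    {n : ℕ} (hn : n < 2 * K) :
    runAll γ ω ((List.range' 1 n).map fun j => Op.gate .X (leg K anc j) (bit 0 j))
      (upState anc ψ R (fun i => m (bit 0 i)) 1, m) =
      (upState anc ψ R (fun i => decide (n < i) && m (bit 0 i)) 1, m) := by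
  induction n with
  | zero =>
    refine Prod.ext (funext fun z => ?_) rfl
    simp only [upState, List.range'_zero, List.map_nil, runAll_nil]
    congr 2
    refine Finset.prod_congr rfl fun i hi => ?_
    rw [Finset.mem_Ico] at hi
    simp [legDelta, show 0 < i by omega]
  | succ n ih =>
    rw [List.range'_1_concat, List.map_append, runAll_append, ih (by omega), List.map_singleton,
      runAll_cons, runAll_nil]
    refine Prod.ext (funext fun z => ?_) rfl
    have hmem : 1 + n ∈ Finset.Ico 1 (2 * K) := Finset.mem_Ico.2 (by omega)
    have hother : ∀ i ∈ (Finset.Ico 1 (2 * K)).erase (1 + n), ∀ v,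
        legDelta K anc (fun i => decide (n < i) && m (bit 0 i)) i
          (Function.update z (.inr (anc (1 + n))) v) =
        legDelta K anc (fun i => decide (n + 1 < i) && m (bit 0 i)) i z := by
      intro i hi v
      rw [Finset.mem_erase, Finset.mem_Ico] at hi
      rw [legDelta_update hanc _ (by omega) (by omega) hi.1]
      refine legDelta_congr ?_ z
      rw [show decide (n + 1 < i) = decide (n < i) from decide_eq_decide.2 (by omega)]
    simp only [Op.run]
    cases hc : m (bit 0 (1 + n)) with
    | false =>
      simp only [Bool.false_eq_true, if_false, upState]
      congr 2
      refine Finset.prod_congr rfl fun i hi => legDelta_congr ?_ z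
      rcases eq_or_ne i (1 + n) with rfl | h
      · simp [hc]
      · rw [show decide (n + 1 < i) = decide (n < i) from decide_eq_decide.2 (by omega)]
    | true =>
      simp only [if_true, Pauli.act, leg, upState, Finset.Ico_self, Finset.prod_empty, mul_one]
      rw [dataOf_update, hR.ancOf (by omega), ← Finset.mul_prod_erase _ _ hmem,
        ← Finset.mul_prod_erase _ _ hmem, Finset.prod_congr rfl fun i hi => hother i hi _]
      congr 2
      simp only [legDelta, dataOf_update, leg, Function.update_self, hc,
        show n < 1 + n by omega, show ¬ n + 1 < 1 + n by omega, decide_true, decide_false,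
        Bool.true_and, Bool.false_and, Bool.xor_true, Bool.xor_false, Bool.not_inj_iff]

/-- The state after the uncomputation of the values of the nodes before `i`. -/
noncomputable def downState (anc : ℕ → Fin A) (ψ : State (Fin K)) (R : State (Fin A))
    (f : ℕ → Bool) (i : ℕ) : State (Fin K ⊕ Fin A) := fun z =>
  ψ (dataOf z) * R (ancOf z) *
    (∏ j ∈ Finset.Ico (2 * i) (2 * K), legDelta K anc (fun _ => false) j z) *
    ∏ j ∈ Finset.Ico i (2 * i), sgn (f j && val (dataOf z) j)

theorem rootOps_run (γ : ℝ) (ω m : ℕ → Bool) (hanc : Set.InjOn anc (Set.Iio (4 * K)))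
    (hK : 1 ≤ K) (R : State (Fin A)) (hR : FreeOf anc R fun n => 1 ≤ n ∧ n < 2 * K)
    (hm : ∀ s u, 9 ≤ s → m (bit s u) = false) :
    ∃ (R' : State (Fin A)) (m' : ℕ → Bool), (∀ s u, 10 ≤ s → m' (bit s u) = false) ∧
      (FreeOf anc R' fun n => 2 ≤ n ∧ n < 2 * K) ∧
      ∀ ψ : State (Fin K), runAll γ ω (rootOps K anc) (upState anc ψ R (fun _ => false) 1, m) =
        (downState anc ((phaseGate K γ).mulVec ψ) R' (fun i => m' (bit 9 i)) 1, m') := by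
  obtain ⟨χ, hχ⟩ := meas_X_run γ ω m (leg K anc 1) (bit 0 1) (bit 9 1)
  refine ⟨fun y => R y * χ (y (anc 1)), Function.update m (bit 9 1) (ω (bit 9 1)), ?_, ?_,
    fun ψ => ?_⟩
  · intro s u h
    rw [Function.update_of_ne (by rw [ne_eq, bit_inj]; omega), hm s u (by omega)]
  · intro n hn y v
    change R _ * χ _ = _
    rw [hR n (by omega), Function.update_of_ne]
    exact fun e => absurd (hanc (Set.mem_Iio.2 (by omega)) (Set.mem_Iio.2 (by omega)) e)
      (by omega)
  rw [rootOps, runAll_cons, runAll_cons, runAll_nil,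
    show (Op.phase (leg K anc 1)).run γ ω (upState anc ψ R (fun _ => false) 1, m) =
      (phaseAct γ (leg K anc 1) (upState anc ψ R (fun _ => false) 1), m) from rfl, hχ]
  refine Prod.ext (funext fun z => ?_) rfl
  have hother : ∀ v, ∏ i ∈ Finset.Ico (1 + 1) (2 * K),
      legDelta K anc (fun _ => false) i (Function.update z (.inr (anc 1)) v) =
        ∏ i ∈ Finset.Ico (2 * 1) (2 * K), legDelta K anc (fun _ => false) i z := fun v => by
    refine Finset.prod_congr rfl fun i hi => ?_
    rw [Finset.mem_Ico] at hi
    exact legDelta_update hanc _ (by omega) (by omega) (by omega) z v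
  have hval : (dataOf z = fun _ => true) ↔ val (dataOf z) 1 = true := (val_one hK _).symm
  simp only [downState, phaseAct, upState, Finset.Ico_self, Finset.prod_empty, mul_one,
    Finset.prod_eq_prod_Ico_succ_bot (show 1 < 2 * K by omega), leg, dataOf_update,
    hR.ancOf (show 1 ≤ 1 ∧ 1 < 2 * K by omega), hother, phaseGate_eq_diagonal,
    Matrix.mulVec_diagonal, Fintype.sum_bool, Function.update_self, hval,
    show Finset.Ico 1 2 = {1} from rfl, Finset.prod_singleton, ancOf]
  simp only [legDelta, dataOf_update, leg, Function.update_self]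
  cases val (dataOf z) 1 <;> simp <;> ring

/-- The pending signs sit on the nodes in [j, 2j), whose legs are already erased. The step removes j
from this frontier and adds 2j and 2j+1; at j = K the frontier is the set of leaves. -/
theorem downState_step (γ : ℝ) (ω m : ℕ → Bool) (hanc : Set.InjOn anc (Set.Iio (4 * K))) {j : ℕ}
    (hj : 1 ≤ j) (hjK : j < K) (R : State (Fin A))
    (hm : ∀ s u, 10 ≤ s → j ≤ u → m (bit s u) = false)
    (hR : FreeOf anc R fun n => 2 * j ≤ n ∧ n < 2 * K) :
    ∃ (R' : State (Fin A)) (m' : ℕ → Bool),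
      (∀ s u, 10 ≤ s → j + 1 ≤ u → m' (bit s u) = false) ∧
      (FreeOf anc R' fun n => 2 * (j + 1) ≤ n ∧ n < 2 * K) ∧
      ∀ ψ : State (Fin K),
        runAll γ ω (downNode K anc j) (downState anc ψ R (fun i => m (bit 9 i)) j, m) =
          (downState anc ψ R' (fun i => m' (bit 9 i)) (j + 1), m') := by
  obtain ⟨χ, m', hm', hrun⟩ := downNode_run γ ω m hanc hjK fun s h₁ h₂ => hm s j h₁ le_rfl
  refine ⟨fun y => R y * χ (y (anc (2 * j))) (y (anc (2 * j + 1))), m', ?_, ?_, fun ψ => ?_⟩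
  · intro s u h₁ h₂
    rw [hm' s u (by omega), hm s u h₁ (by omega)]
  · intro n hn y v
    change R _ * χ _ _ = _
    rw [hR n (by omega), Function.update_of_ne, Function.update_of_ne]
    · exact fun e => absurd (hanc (Set.mem_Iio.2 (by omega)) (Set.mem_Iio.2 (by omega)) e)
        (by omega)
    · exact fun e => absurd (hanc (Set.mem_Iio.2 (by omega)) (Set.mem_Iio.2 (by omega)) e)
        (by omega)
  set E : State (Fin K ⊕ Fin A) := fun z => ψ (dataOf z) * R (ancOf z) *
    (∏ i ∈ Finset.Ico (2 * (j + 1)) (2 * K), legDelta K anc (fun _ => false) i z) *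
      ∏ i ∈ Finset.Ico (j + 1) (2 * j), sgn (m (bit 9 i) && val (dataOf z) i) with hE
  have hfree : ∀ n, n = 2 * j ∨ n = 2 * j + 1 → ∀ z v,
      E (Function.update z (.inr (anc n)) v) = E z := by
    intro n hn z v
    simp only [hE]
    rw [dataOf_update, hR.ancOf (by omega)]
    congr 2
    refine Finset.prod_congr rfl fun i hi => ?_
    rw [Finset.mem_Ico] at hi
    exact legDelta_update hanc _ (by omega) (by omega) (by omega) z v
  have h₁ : downState anc ψ R (fun i => m (bit 9 i)) j = fun z => E z *
      (if z (leg K anc (2 * j)) = val (dataOf z) (2 * j) then 1 else 0) *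
      (if z (leg K anc (2 * j + 1)) = val (dataOf z) (2 * j + 1) then 1 else 0) *
      sgn (m (bit 9 j) && (val (dataOf z) (2 * j) && val (dataOf z) (2 * j + 1))) := by
    funext z
    simp only [downState, hE, Finset.prod_eq_prod_Ico_succ_bot (show 2 * j < 2 * K by omega),
      Finset.prod_eq_prod_Ico_succ_bot (show 2 * j + 1 < 2 * K by omega),
      Finset.prod_eq_prod_Ico_succ_bot (show j < 2 * j by omega), val_node (dataOf z) hj hjK,
      show 2 * j + 1 + 1 = 2 * (j + 1) by ring]
    simp only [legDelta, Bool.xor_false]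
    ring
  rw [h₁, hrun E _ _ (hfree _ (.inl rfl)) (hfree _ (.inr rfl))
    (fun z i v => by rw [leg, dataOf_update]) (fun z i v => by rw [leg, dataOf_update])]
  refine Prod.ext (funext fun z => ?_) rfl
  have h₂ : ∏ i ∈ Finset.Ico (j + 1) (2 * j), sgn (m' (bit 9 i) && val (dataOf z) i) =
      ∏ i ∈ Finset.Ico (j + 1) (2 * j), sgn (m (bit 9 i) && val (dataOf z) i) := by
    refine Finset.prod_congr rfl fun i hi => ?_
    rw [Finset.mem_Ico] at hi
    rw [hm' 9 i (by omega)]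
  simp only [downState, hE]
  rw [show Finset.Ico (j + 1) (2 * (j + 1)) = Finset.Ico (j + 1) (2 * j + 1 + 1) from rfl,
    Finset.prod_Ico_succ_top (by omega), Finset.prod_Ico_succ_top (by omega), h₂]
  simp only [ancOf, leg]
  ring

theorem downState_run (γ : ℝ) (ω m : ℕ → Bool) (hanc : Set.InjOn anc (Set.Iio (4 * K)))
    (R : State (Fin A)) (hm : ∀ s u, 10 ≤ s → m (bit s u) = false)
    (hR : FreeOf anc R fun n => 2 ≤ n ∧ n < 2 * K) {n : ℕ} (hn : n < K) :
    ∃ (R' : State (Fin A)) (m' : ℕ → Bool),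
      (∀ s u, 10 ≤ s → n + 1 ≤ u → m' (bit s u) = false) ∧
      (FreeOf anc R' fun i => 2 * (n + 1) ≤ i ∧ i < 2 * K) ∧
      ∀ ψ : State (Fin K), runAll γ ω ((List.range' 1 n).flatMap (downNode K anc))
        (downState anc ψ R (fun i => m (bit 9 i)) 1, m) =
          (downState anc ψ R' (fun i => m' (bit 9 i)) (n + 1), m') := by
  induction n with
  | zero => exact ⟨R, m, fun s u h _ => hm s u h, hR, fun ψ => rfl⟩
  | succ n ih =>
    obtain ⟨R₁, m₁, hm₁, hR₁, hrun₁⟩ := ih (by omega)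
    obtain ⟨R₂, m₂, hm₂, hR₂, hrun₂⟩ :=
      downState_step γ ω m₁ hanc (j := n + 1) (by omega) hn R₁ hm₁ hR₁
    refine ⟨R₂, m₂, hm₂, hR₂, fun ψ => ?_⟩
    rw [List.range'_1_concat, List.flatMap_append, runAll_append, hrun₁,
      List.flatMap_singleton, Nat.add_comm 1 n, hrun₂]

end Invariants

/-! ### Initial state, the circuit and its correctness. -/

section Assembly

variable {K A : ℕ} {anc : ℕ → Fin A}

/-- A ZZ measurement with outcome b projects onto leg = data bit + b, so the outcome itself is the
flip of the leaf. -/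
theorem leafPairs_run (γ : ℝ) (ω : ℕ → Bool) :
    ∃ m : ℕ → Bool, (∀ s u, 3 ≤ s → m (bit s u) = false) ∧ ∀ Φ : State (Fin K ⊕ Fin A),
      runAll γ ω [.merge (leafPairs K anc)] (Φ, fun _ => false) =
        (fun z => Φ z * ∏ j ∈ Finset.Ico K (2 * K), legDelta K anc (fun i => m (bit 0 i)) j z,
          m) := by
  have hmem : ∀ (l : List (Fin K)) (m' : ℕ → Bool) (b : ℕ),
      (l.map (leafPair anc)).foldl (fun m' p => p.record ω (fun _ => false) m') m' b =
        if ∃ i ∈ l, b = bit 0 (K + i) then ω b else m' b := by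
    intro l
    induction l with
    | nil => intro m' b; simp
    | cons i l ih =>
      intro m' b
      rw [List.map_cons, List.foldl_cons, ih]
      by_cases h : ∃ i ∈ l, b = bit 0 (K + i)
      · obtain ⟨i', hi', hb⟩ := h
        rw [if_pos ⟨i', hi', hb⟩, if_pos ⟨i', by simp [hi'], hb⟩]
      · rw [if_neg h]
        change Function.update m' (bit 0 (K + i)) (ω (bit 0 (K + i))) b = _
        by_cases hb : b = bit 0 (K + i)
        · rw [hb, Function.update_self, if_pos ⟨i, by simp, rfl⟩]
        · rw [Function.update_of_ne hb, if_neg]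
          rintro ⟨i', hi', hb'⟩
          rcases List.mem_cons.1 hi' with rfl | hi'
          · exact hb hb'
          · exact h ⟨i', hi', hb'⟩
  have hstate : ∀ (l : List (Fin K)) (Φ : State (Fin K ⊕ Fin A)),
      (l.map (leafPair anc)).foldl (fun φ p => p.project ω (fun _ => false) φ) Φ =
        fun z => Φ z * (l.map fun i : Fin K =>
          legDelta K anc (fun j => ω (bit 0 j)) (K + i) z).prod := by
    intro l
    induction l with
    | nil => intro Φ; simp
    | cons i l ih =>
      intro Φ
      rw [List.map_cons, List.foldl_cons, ih]
      funext z
      rw [List.map_cons, List.prod_cons, ← mul_assoc]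
      congr 1
      simp only [PairMeas.project, leafPair, outcomeProj, Pauli.act, legDelta, val_leaf, dataOf]
      rcases Bool.eq_false_or_eq_true (z (.inl i)) with h₁ | h₁ <;>
        rcases Bool.eq_false_or_eq_true (z (leg K anc (K + i))) with h₂ | h₂ <;>
        rcases Bool.eq_false_or_eq_true (ω (bit 0 (K + i))) with h₃ | h₃ <;> simp [h₁, h₂, h₃]
  refine ⟨(leafPairs K anc).foldl (fun m' p => p.record ω (fun _ => false) m') fun _ => false,
    fun s u h => ?_, fun Φ => Prod.ext (funext fun z => ?_) rfl⟩
  · rw [leafPairs, hmem, if_neg]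
    rintro ⟨i, _, hi⟩
    rw [bit_inj] at hi
    omega
  · change (leafPairs K anc).foldl (fun φ p => p.project ω (fun _ => false) φ) Φ z = _
    rw [leafPairs, hstate]
    dsimp only
    rw [← Fin.prod_univ_def, Finset.prod_Ico_eq_prod_range,
      show 2 * K - K = K by omega, ← Fin.prod_univ_eq_prod_range
        (fun i => legDelta K anc _ (K + i) z)]
    congr 1
    refine Finset.prod_congr rfl fun i _ => legDelta_congr ?_ z
    rw [hmem, if_pos ⟨i, by simp, rfl⟩]

/-- Numbers of the ancillas that hold the qubits of the `i`-th CCZ state. -/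
def cczIndex (K i : ℕ) : Fin 3 → ℕ :=
  ![2 * (1 + i), 2 * (1 + i) + 1, 2 * K + (2 * (1 + i) + 1)]

theorem cczIndex_lt {i : ℕ} (hi : i < K - 1) (k : Fin 3) : cczIndex K i k < 4 * K := by
  fin_cases k <;> simp [cczIndex] <;> omega

theorem cczIndex_inj {i i' : ℕ} (hi : i < K - 1) (hi' : i' < K - 1) {k k' : Fin 3}
    (h : cczIndex K i k = cczIndex K i' k') : i = i' ∧ k = k' := by
  fin_cases k <;> fin_cases k' <;> simp [cczIndex] at h ⊢ <;> omega

/-- The circuit for `K` data qubits, given `4 * K` distinct ancillas. -/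
noncomputable def treeCircuit (hanc : Set.InjOn anc (Set.Iio (4 * K))) (hK : 2 ≤ K) :
    Circuit K A where
  numCCZ := K - 1
  ccz := ⟨fun p => anc (cczIndex K p.1 p.2), fun p p' h => by
    obtain ⟨h₁, h₂⟩ := cczIndex_inj p.1.2 p'.1.2
      (hanc (cczIndex_lt p.1.2 p.2) (cczIndex_lt p'.1.2 p'.2) h)
    exact Prod.ext (Fin.ext h₁) h₂⟩
  plus := {anc 1}
  -- `circuitOps` counts depth from L + 1, and ⌈log₂ K⌉ ≥ 1 as K ≥ 2.
  ops := circuitOps K anc (Nat.clog 2 K - 1)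
  corr i := bit 9 (K + i)
  writes_nodup := circuitOps_writes_nodup hanc (by omega) (by
    have := Nat.clog_pos (b := 2) (by norm_num) hK
    rw [show Nat.clog 2 K - 1 + 1 = Nat.clog 2 K by omega]
    exact Nat.le_pow_clog (by norm_num) K)
  merge_disjoint := circuitOps_merge_nodup hanc _

/-- CCZ amplitudes are signs up to the constant 1/√8 and |+⟩ is constant, so `R` holds only
constants and the idle ancillas; the set `T` of copies in |0⟩ supplies the remaining factor of
`nodeAmp`. -/
theorem treeCircuit_ancillaState (hanc : Set.InjOn anc (Set.Iio (4 * K))) (hK : 2 ≤ K) :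
    ∃ R : State (Fin A),
      (FreeOf anc R fun n => (1 ≤ n ∧ n < 2 * K) ∨ (2 * K + 2 ≤ n ∧ n < 2 * K + 2 * K)) ∧
      ∀ z : Fin K ⊕ Fin A → Bool, (treeCircuit hanc hK).ancillaState (ancOf z) =
        R (ancOf z) * ∏ j ∈ Finset.Ico 1 K, nodeAmp K anc j z := by
  set V := treeCircuit hanc hK
  have hne : ∀ i j, i < 4 * K → j < 4 * K → i ≠ j → anc i ≠ anc j := fun i j hi hj h e =>
    h (hanc hi hj e)
  have hccz : ∀ a, a ∈ (Finset.univ.map V.ccz) ↔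
      ∃ i : Fin (K - 1), ∃ k, anc (cczIndex K i k) = a := by
    intro a
    simp only [Finset.mem_map, Finset.mem_univ, true_and, Prod.exists]
    rfl
  let f : Fin A → (Fin A → Bool) → ℂ := fun a y =>
    if a ∈ V.plus then 1 / (Real.sqrt 2 : ℂ) else if y a then 0 else 1
  let T : Finset (Fin A) := (Finset.Ico 1 K).image fun j => anc (2 * K + 2 * j)
  have hT : T ⊆ (Finset.univ.map V.ccz)ᶜ := by
    intro a ha
    obtain ⟨j, hj, rfl⟩ := Finset.mem_image.1 ha
    rw [Finset.mem_Ico] at hj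
    rw [Finset.mem_compl, hccz]
    rintro ⟨i, k, h⟩
    have := hanc (cczIndex_lt i.2 k) (Set.mem_Iio.2 (by omega)) h
    fin_cases k <;> simp [cczIndex] at this <;> omega
  refine ⟨fun y => (1 / (Real.sqrt 8 : ℂ)) ^ (K - 1) *
    ∏ a ∈ (Finset.univ.map V.ccz)ᶜ \ T, f a y, ?_, fun z => ?_⟩
  · intro n hn y v
    change _ * _ = _ * _
    congr 1
    refine Finset.prod_congr rfl fun a ha => ?_
    rw [Finset.mem_sdiff, Finset.mem_compl, hccz] at ha
    by_cases han : a = anc n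
    · rcases eq_or_ne n 1 with rfl | hn1
      · have : a ∈ V.plus := Finset.mem_singleton.2 han
        simp only [f, if_pos this]
      · exfalso
        rcases hn with hn | hn
        · rcases Nat.mod_two_eq_zero_or_one n with h | h
          · refine ha.1 ⟨⟨n / 2 - 1, by omega⟩, 0, ?_⟩
            rw [han]
            congr 1
            simp [cczIndex]
            omega
          · refine ha.1 ⟨⟨n / 2 - 1, by omega⟩, 1, ?_⟩
            rw [han]
            congr 1
            simp [cczIndex]
            omega
        · rcases Nat.mod_two_eq_zero_or_one n with h | h
          · refine ha.2 (Finset.mem_image.2 ⟨n / 2 - K, Finset.mem_Ico.2 (by omega), ?_⟩)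
            rw [han]
            congr 1
            omega
          · refine ha.1 ⟨⟨n / 2 - K - 1, by omega⟩, 2, ?_⟩
            rw [han]
            congr 1
            simp [cczIndex]
            omega
    · simp only [f, Function.update_of_ne han]
  · have h₁ : ∏ i : Fin (K - 1), cczAmp (ancOf z (V.ccz (i, 0))) (ancOf z (V.ccz (i, 1)))
        (ancOf z (V.ccz (i, 2))) = (1 / (Real.sqrt 8 : ℂ)) ^ (K - 1) * ∏ j ∈ Finset.Ico 1 K,
          sgn (z (car K anc (2 * j + 1)) && (z (leg K anc (2 * j)) && z (leg K anc (2 * j + 1)))) := by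
      rw [Finset.prod_Ico_eq_prod_range, ← Fin.prod_univ_eq_prod_range
        (fun i => sgn (z (car K anc (2 * (1 + i) + 1)) &&
          (z (leg K anc (2 * (1 + i))) && z (leg K anc (2 * (1 + i) + 1)))))]
      have hc : (1 / (Real.sqrt 8 : ℂ)) ^ (K - 1) = ∏ _i : Fin (K - 1), 1 / (Real.sqrt 8 : ℂ) := by
        simp
      rw [hc, ← Finset.prod_mul_distrib]
      refine Finset.prod_congr rfl fun i _ => ?_
      have e₀ : ancOf z (V.ccz (i, 0)) = z (leg K anc (2 * (1 + i))) := rfl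
      have e₁ : ancOf z (V.ccz (i, 1)) = z (leg K anc (2 * (1 + i) + 1)) := rfl
      have e₂ : ancOf z (V.ccz (i, 2)) = z (car K anc (2 * (1 + i) + 1)) := rfl
      rw [e₀, e₁, e₂, cczAmp, Bool.and_comm (z (car K anc (2 * (1 + i) + 1))), sgn]
      ring
    have h₂ : ∏ a ∈ T, f a (ancOf z) =
        ∏ j ∈ Finset.Ico 1 K, if z (car K anc (2 * j)) then (0 : ℂ) else 1 := by
      rw [Finset.prod_image fun i hi j hj h => ?_]
      · refine Finset.prod_congr rfl fun j hj => ?_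
        rw [Finset.mem_Ico] at hj
        have : anc (2 * K + 2 * j) ∉ V.plus := fun h =>
          hne (2 * K + 2 * j) 1 (by omega) (by omega) (by omega) (Finset.mem_singleton.1 h)
        simp only [f, if_neg this]
        rfl
      · rw [Finset.mem_coe, Finset.mem_Ico] at hi hj
        have := hanc (Set.mem_Iio.2 (by omega)) (Set.mem_Iio.2 (by omega)) h
        omega
    refine (congrArg (· * _) h₁).trans ?_
    rw [← Finset.prod_sdiff hT]
    change _ * (_ * ∏ a ∈ T, f a (ancOf z)) = _
    rw [h₂]
    simp only [nodeAmp, Finset.prod_mul_distrib]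
    change _ * ((∏ a ∈ (Finset.univ.map V.ccz)ᶜ \ T, f a (ancOf z)) * _) = _
    ring

theorem treeCircuit_zEquivalent (hanc : Set.InjOn anc (Set.Iio (4 * K))) (hK : 2 ≤ K) (γ : ℝ) :
    (treeCircuit hanc hK).ZEquivalent γ (phaseGate K γ) := by
  intro ω
  have hL : K ≤ 2 ^ (Nat.clog 2 K - 1 + 1) := by
    have := Nat.clog_pos (b := 2) (by norm_num) hK
    rw [show Nat.clog 2 K - 1 + 1 = Nat.clog 2 K by omega]
    exact Nat.le_pow_clog (by norm_num) K
  obtain ⟨R₀, hR₀, hstart⟩ := treeCircuit_ancillaState hanc hK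
  obtain ⟨m₁, hm₁, hrun₁⟩ := leafPairs_run (K := K) (anc := anc) γ ω
  obtain ⟨R₂, m₂, hm₂, hR₂, hrun₂⟩ := upState_run γ ω m₁ hanc R₀ hm₁ hR₀
    (n := K - 1) (by omega)
  rw [show K - (K - 1) = 1 by omega] at hm₂ hR₂ hrun₂
  have hR₂' : FreeOf anc R₂ fun n => 1 ≤ n ∧ n < 2 * K := fun n hn => hR₂ n (.inl hn)
  obtain ⟨R₃, m₃, hm₃, hR₃, hrun₃⟩ := rootOps_run γ ω m₂ hanc (by omega) R₂ hR₂'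
    fun s u h => hm₂ s u (.inr h)
  obtain ⟨R₄, m₄, -, -, hrun₄⟩ := downState_run γ ω m₃ hanc R₃ hm₃ hR₃ (n := K - 1) (by omega)
  rw [show K - 1 + 1 = K by omega] at hrun₄
  refine ⟨R₄, fun ψ => ?_⟩
  have hinit : (fun z => tensor ψ (treeCircuit hanc hK).ancillaState z *
      ∏ j ∈ Finset.Ico K (2 * K), legDelta K anc (fun i => m₁ (bit 0 i)) j z) =
      upState anc ψ R₀ (fun i => m₁ (bit 0 i)) K := by
    funext z
    have : tensor ψ (treeCircuit hanc hK).ancillaState z =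
      ψ (dataOf z) * (treeCircuit hanc hK).ancillaState (ancOf z) := rfl
    rw [this, hstart, upState]
    ring
  have hframe : upState anc ψ R₂ (fun i => decide (2 * K - 1 < i) && m₂ (bit 0 i)) 1 =
      upState anc ψ R₂ (fun _ => false) 1 := by
    funext z
    rw [upState, upState]
    congr 2
    refine Finset.prod_congr rfl fun i hi => legDelta_congr ?_ z
    rw [Finset.mem_Ico] at hi
    simp [show ¬ 2 * K - 1 < i by omega]
  have hrun : (treeCircuit hanc hK).run γ ω ψ =
      (downState anc ((phaseGate K γ).mulVec ψ) R₄ (fun i => m₄ (bit 9 i)) K, m₄) := by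
    change runAll γ ω (circuitOps K anc (Nat.clog 2 K - 1)) _ = _
    rw [(circuitOps_reorders hanc (by omega) hL).run, sequentialOps, runAll_append, runAll_append,
      runAll_append, runAll_append, hrun₁, hinit, hrun₂, frameGates,
      frameGates_run γ ω m₂ hanc ψ R₂ hR₂' (by omega), hframe, hrun₃, hrun₄]
  funext z
  rw [Circuit.correctedOutput, hrun]
  have hsign : ∏ j ∈ Finset.Ico K (2 * K), sgn (m₄ (bit 9 j) && val (dataOf z) j) =
      ∏ i : Fin K, sgn (m₄ (bit 9 (K + i)) && z (.inl i)) := by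
    rw [Finset.prod_Ico_eq_prod_range, show 2 * K - K = K by omega, ← Fin.prod_univ_eq_prod_range
      (fun i => sgn (m₄ (bit 9 (K + i)) && val (dataOf z) (K + i)))]
    simp only [val_leaf, dataOf]
  simp only [downState, Finset.Ico_self, Finset.prod_empty, mul_one, hsign]
  -- The corrections repeat exactly the signs that are left, and signs square to 1.
  have hsq : (∏ i : Fin K, sgn (m₄ (bit 9 (K + i)) && z (.inl i))) *
      ∏ i : Fin K, sgn (m₄ (bit 9 (K + i)) && z (.inl i)) = 1 := by
    rw [← Finset.prod_mul_distrib]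
    exact Finset.prod_eq_one fun i _ => sgn_mul_self _
  change (∏ i : Fin K, sgn (m₄ (bit 9 (K + i)) && z (.inl i))) * _ =
    (phaseGate K γ).mulVec ψ (dataOf z) * R₄ (ancOf z)
  rw [mul_comm, mul_assoc, hsq, mul_one]

end Assembly

/-! ### The two sums for the number of CCZ states. -/

section Levels

theorem ceil_div_two_pow_succ (K n : ℕ) :
    ⌈(K : ℚ) / 2 ^ (n + 1)⌉₊ = (⌈(K : ℚ) / 2 ^ n⌉₊ + 1) / 2 := by
  refine eq_of_forall_ge_iff fun m => ?_
  have h : (⌈(K : ℚ) / 2 ^ n⌉₊ + 1) / 2 ≤ m ↔ ⌈(K : ℚ) / 2 ^ n⌉₊ ≤ 2 * m := by omega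
  rw [h, Nat.ceil_le, Nat.ceil_le, pow_succ, ← div_div, div_le_iff₀ (by norm_num)]
  push_cast
  rw [mul_comm]

/-- If c nodes remain, ⌊c/2⌋ pairs are joined and ⌈c/2⌉ nodes remain, so the sum telescopes. -/
theorem sum_half_ceil_add (K n : ℕ) :
    ∑ ℓ ∈ Finset.Icc 1 n, ⌈(K : ℚ) / 2 ^ (ℓ - 1)⌉₊ / 2 + ⌈(K : ℚ) / 2 ^ n⌉₊ = K := by
  induction n with
  | zero => simp
  | succ n ih =>
    rw [Finset.sum_Icc_succ_top (by omega), ceil_div_two_pow_succ, Nat.add_sub_cancel]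
    omega

theorem sum_half_ceil {K : ℕ} (hK : 1 ≤ K) :
    ∑ ℓ ∈ Finset.Icc 1 (Nat.clog 2 K), ⌈(K : ℚ) / 2 ^ (ℓ - 1)⌉₊ / 2 = K - 1 := by
  have h := sum_half_ceil_add K (Nat.clog 2 K)
  have h₁ : ⌈(K : ℚ) / 2 ^ Nat.clog 2 K⌉₊ = 1 := by
    refine le_antisymm (Nat.ceil_le.2 ?_) (Nat.ceil_pos.2 (by positivity))
    rw [Nat.cast_one, div_le_one (by positivity)]
    exact_mod_cast Nat.le_pow_clog (by norm_num) K
  omega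

theorem sum_two_pow_div (L : ℕ) :
    ∑ ℓ ∈ Finset.Icc 1 (Nat.clog 2 (2 ^ L)), 2 ^ L / 2 ^ ℓ = 2 ^ L - 1 := by
  rw [← sum_half_ceil Nat.one_le_two_pow]
  refine Finset.sum_congr rfl fun ℓ hℓ => ?_
  rw [Nat.clog_pow 2 L (by norm_num), Finset.mem_Icc] at hℓ
  obtain ⟨k, rfl⟩ := Nat.exists_eq_add_of_le hℓ.2
  obtain ⟨i, rfl⟩ := Nat.exists_eq_add_of_le' hℓ.1
  have h : ((2 ^ (i + 1 + k) : ℕ) : ℚ) / 2 ^ i = (2 ^ (k + 1) : ℕ) := by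
    rw [div_eq_iff (by positivity)]
    push_cast
    ring
  rw [Nat.add_sub_cancel, h, Nat.ceil_natCast, pow_succ 2 k, Nat.mul_div_cancel _ (by norm_num),
    pow_add, Nat.mul_div_cancel_left _ (by positivity)]

end Levels

end LatticeSurgery

theorem mainTheorem1 :
    ∃ p : Polynomial ℕ, ∀ K : ℕ, 2 ≤ K →
      ∃ V : LatticeSurgery.Circuit K (13 * K / 2),
        (∀ γ : ℝ, V.ZEquivalent γ (LatticeSurgery.phaseGate K γ)) ∧
        V.AddressesDataForOneCycle ∧
        V.numCCZ = ∑ ℓ ∈ Finset.Icc 1 (Nat.clog 2 K), ⌈(K : ℚ) / 2 ^ (ℓ - 1)⌉₊ / 2 ∧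
        V.numCCZ = K - 1 ∧
        (∀ L : ℕ, K = 2 ^ L → V.numCCZ = ∑ ℓ ∈ Finset.Icc 1 (Nat.clog 2 K), K / 2 ^ ℓ) ∧
        (∀ nP : ℕ, V.cycles nP = nP + 4 * Nat.clog 2 K) ∧
        V.size ≤ p.eval K := by
  refine ⟨27 * Polynomial.X, fun K hK => ?_⟩
  -- The tree uses only 4K-3 ancillas, 2K-1 legs and 2K-2 carriers, with numbers below 4K; the
  -- others stay in |0⟩. The remainder in `anc` only makes it total.
  have hA : 4 * K ≤ 13 * K / 2 := by omega
  let anc : ℕ → Fin (13 * K / 2) := fun n => ⟨n % (13 * K / 2), Nat.mod_lt _ (by omega)⟩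
  have hanc : Set.InjOn anc (Set.Iio (4 * K)) := by
    intro i hi j hj h
    rw [Set.mem_Iio] at hi hj
    have := congrArg Fin.val h
    simp only [anc] at this
    rwa [Nat.mod_eq_of_lt (by omega), Nat.mod_eq_of_lt (by omega)] at this
  have hclog : Nat.clog 2 K - 1 + 1 = Nat.clog 2 K := by
    have := Nat.clog_pos (b := 2) (by norm_num) hK
    omega
  refine ⟨LatticeSurgery.treeCircuit hanc hK,
    fun γ => LatticeSurgery.treeCircuit_zEquivalent hanc hK γ,
    -- The data layer is the very first instruction.
    ⟨[], _, _, rfl, LatticeSurgery.laterOps_inl_notMem _⟩,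
    (LatticeSurgery.sum_half_ceil (by omega)).symm, rfl, ?_, fun nP => ?_, ?_⟩
  · rintro L rfl
    exact (LatticeSurgery.sum_two_pow_div L).symm
  · refine (LatticeSurgery.circuitOps_cycles nP _).trans ?_
    rw [hclog]
  · refine (LatticeSurgery.circuitOps_size hanc (by omega) ?_).trans (by simp)
    rw [hclog]
    exact Nat.le_pow_clog (by norm_num) K
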